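/- Let $G$ be a compact connected semisimple Lie group with Lie algebra $\mathfrak g$ and Killing form $B$, let $H\subset G$ be a closed subgroup with Lie algebra $\mathfrak h$, and let $G/H$ be reductive with reductive decomposition $\mathfrak g=\mathfrak h\oplus\mathfrak m$, $\mathrm{Ad}(H)\mathfrak m\subset\mathfrak m$, the complement $\mathfrak m$ being identified with the tangent space $T_o(G/H)$ at $o=H$. Suppose that $\mathfrak m=\mathfrak m_1\oplus\mathfrak m_2\oplus\mathfrak m_3$ is a $B$-orthogonal direct sum of $\mathrm{Ad}(H)$-invariant, irreducible, mutually inequivalent submodules such that, with indices taken modulo $3$, $$0\neq[\mathfrak m_i,\mathfrak m_{i+1}]\subset\mathfrak m_{i+2},\qquad [\mathfrak m_i,\mathfrak m_i]\subset\mathfrak h\qquad(i=1,2,3).$$ Let $g$ be an arbitrary $G$-invariant Riemannian metric on $G/H$ with Levi-Civita connection $\nabla$, and let $f$ be a $G$-invariant field of endomorphisms of the tangent bundle of $G/H$ such that $f^3+f=0$ and $g(fX,Y)+g(X,fY)=0$ for all vector fields $X,Y$. Suppose that, for some $i$, at the point $o$ the restriction of $f$ to $\mathfrak m_i$ is an almost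 complex structure $J$ (that is, $J:\mathfrak m_i\to\mathfrak m_i$ is linear with $J^2=-\mathrm{id}$), and $f$ vanishes on the other two summands. Write $\nabla_X(f)Y=\nabla_X(fY)-f(\nabla_XY)$. Then: 1. $(f,g)$ is not a Killing $f$-structure, that is, it is not true that $\nabla_X(f)X=0$ for all smooth vector fields $X$ on $G/H$; 2. $(f,g)$ is a nearly Kähler $f$-structure, that is, $\nabla_{fX}(f)fX=0$ for all smooth vector fields $X$ on $G/H$; consequently it is also a $G_1f$-structure, that is, $T(X,X)=0$ for all smooth vector fields $X$, where $$T(X,Y)=\tfrac14 f\bigl(\nabla_{fX}(f)fY-\nabla_{f^2X}(f)f^2Y\bigr).$$ -/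

import Mathlib

open scoped Manifold ContDiff

noncomputable section

/-! ### Metric `f`-structures on a manifold -/

section Manifolds

variable {F : Type*} [NormedAddCommGroup F] [NormedSpace ℝ F]
  {M : Type*} [TopologicalSpace M] [ChartedSpace F M] [IsManifold 𝓘(ℝ, F) ∞ M]

/-- `X` is a smooth vector field on `M`. -/
def IsSmoothVectorField (X : (p : M) → TangentSpace 𝓘(ℝ, F) p) : Prop :=
  ContMDiff 𝓘(ℝ, F) 𝓘(ℝ, F).tangent ∞ (fun p ↦ (⟨p, X p⟩ : TangentBundle 𝓘(ℝ, F) M))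

/-- The vector field `f X`, for an affinor (field of endomorphisms of the tangent spaces) `f`. -/
def affinorApply (f : (p : M) → TangentSpace 𝓘(ℝ, F) p →L[ℝ] TangentSpace 𝓘(ℝ, F) p)
    (X : (p : M) → TangentSpace 𝓘(ℝ, F) p) : (p : M) → TangentSpace 𝓘(ℝ, F) p :=
  fun p ↦ f p (X p)

/-- `(f, g)` is a metric `f`-structure: `f` is a smooth `(1,1)`-tensor field with `f ^ 3 + f = 0`
and `g (f X, Y) + g (X, f Y) = 0`. -/
structure IsMetricFStructure
    (g : Bundle.ContMDiffRiemannianMetric 𝓘(ℝ, F) ∞ F (fun p : M ↦ TangentSpace 𝓘(ℝ, F) p))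
    (f : (p : M) → TangentSpace 𝓘(ℝ, F) p →L[ℝ] TangentSpace 𝓘(ℝ, F) p) : Prop where
  smooth : ContMDiff 𝓘(ℝ, F) (𝓘(ℝ, F).prod 𝓘(ℝ, F →L[ℝ] F)) ∞
    (fun p ↦ Bundle.TotalSpace.mk' (F →L[ℝ] F)
      (E := fun p : M ↦ TangentSpace 𝓘(ℝ, F) p →L[ℝ] TangentSpace 𝓘(ℝ, F) p) p (f p))
  cube_add_self : ∀ (p : M) (v : TangentSpace 𝓘(ℝ, F) p), f p (f p (f p v)) + f p v = 0
  compatible : ∀ (p : M) (v w : TangentSpace 𝓘(ℝ, F) p),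
    g.inner p (f p v) w + g.inner p v (f p w) = 0

/-- `∇` is the Levi-Civita connection of `g`: it is torsion-free,
`∇_X Y - ∇_Y X = [X, Y]`, and metric, `X (g (Y, Z)) = g (∇_X Y, Z) + g (Y, ∇_X Z)`,
wherever the vector fields are differentiable.
(In Mathlib's notation `∇ Y p (X p)` is the value of `∇_X Y` at `p`.) -/
structure IsLeviCivita
    (g : Bundle.ContMDiffRiemannianMetric 𝓘(ℝ, F) ∞ F (fun p : M ↦ TangentSpace 𝓘(ℝ, F) p))
    (nabla : CovariantDerivative 𝓘(ℝ, F) F (fun p : M ↦ TangentSpace 𝓘(ℝ, F) p)) : Prop where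
  torsion_free : ∀ (X Y : (p : M) → TangentSpace 𝓘(ℝ, F) p) (p : M),
    MDifferentiableAt 𝓘(ℝ, F) 𝓘(ℝ, F).tangent (fun q ↦ (⟨q, X q⟩ : TangentBundle 𝓘(ℝ, F) M)) p →
    MDifferentiableAt 𝓘(ℝ, F) 𝓘(ℝ, F).tangent (fun q ↦ (⟨q, Y q⟩ : TangentBundle 𝓘(ℝ, F) M)) p →
      nabla Y p (X p) - nabla X p (Y p) = VectorField.mlieBracket 𝓘(ℝ, F) X Y p
  metric : ∀ (X Y Z : (p : M) → TangentSpace 𝓘(ℝ, F) p) (p : M),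
    MDifferentiableAt 𝓘(ℝ, F) 𝓘(ℝ, F).tangent (fun q ↦ (⟨q, Y q⟩ : TangentBundle 𝓘(ℝ, F) M)) p →
    MDifferentiableAt 𝓘(ℝ, F) 𝓘(ℝ, F).tangent (fun q ↦ (⟨q, Z q⟩ : TangentBundle 𝓘(ℝ, F) M)) p →
      mvfderiv 𝓘(ℝ, F) (fun q : M ↦ g.inner q (Y q) (Z q)) p (X p) =
        g.inner p (nabla Y p (X p)) (Z p) + g.inner p (Y p) (nabla Z p (X p))

/-- The vector field `∇_X (f) Y = ∇_X (f Y) - f (∇_X Y)`. -/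
def nablaAffinor
    (nabla : CovariantDerivative 𝓘(ℝ, F) F (fun p : M ↦ TangentSpace 𝓘(ℝ, F) p))
    (f : (p : M) → TangentSpace 𝓘(ℝ, F) p →L[ℝ] TangentSpace 𝓘(ℝ, F) p)
    (X Y : (p : M) → TangentSpace 𝓘(ℝ, F) p) : (p : M) → TangentSpace 𝓘(ℝ, F) p :=
  fun p ↦ nabla (affinorApply f Y) p (X p) - f p (nabla Y p (X p))

/-- The composition tensor
`T (X, Y) = 1/4 f (∇_{f X} (f) f Y - ∇_{f² X} (f) f² Y)`. -/
def compositionTensor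
    (nabla : CovariantDerivative 𝓘(ℝ, F) F (fun p : M ↦ TangentSpace 𝓘(ℝ, F) p))
    (f : (p : M) → TangentSpace 𝓘(ℝ, F) p →L[ℝ] TangentSpace 𝓘(ℝ, F) p)
    (X Y : (p : M) → TangentSpace 𝓘(ℝ, F) p) : (p : M) → TangentSpace 𝓘(ℝ, F) p :=
  fun p ↦ (1 / 4 : ℝ) • f p
    (nablaAffinor nabla f (affinorApply f X) (affinorApply f Y) p -
      nablaAffinor nabla f (affinorApply f (affinorApply f X))
        (affinorApply f (affinorApply f Y)) p)

/-- Killing `f`-structures: `∇_X (f) X = 0`. -/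
def IsKillingF
    (nabla : CovariantDerivative 𝓘(ℝ, F) F (fun p : M ↦ TangentSpace 𝓘(ℝ, F) p))
    (f : (p : M) → TangentSpace 𝓘(ℝ, F) p →L[ℝ] TangentSpace 𝓘(ℝ, F) p) : Prop :=
  ∀ X : (p : M) → TangentSpace 𝓘(ℝ, F) p, IsSmoothVectorField X →
    ∀ p : M, nablaAffinor nabla f X X p = 0

/-- Nearly Kähler `f`-structures: `∇_{f X} (f) f X = 0`. -/
def IsNearlyKahlerF
    (nabla : CovariantDerivative 𝓘(ℝ, F) F (fun p : M ↦ TangentSpace 𝓘(ℝ, F) p))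
    (f : (p : M) → TangentSpace 𝓘(ℝ, F) p →L[ℝ] TangentSpace 𝓘(ℝ, F) p) : Prop :=
  ∀ X : (p : M) → TangentSpace 𝓘(ℝ, F) p, IsSmoothVectorField X →
    ∀ p : M, nablaAffinor nabla f (affinorApply f X) (affinorApply f X) p = 0

/-- `G₁f`-structures: `T (X, X) = 0`. -/
def IsG1F
    (nabla : CovariantDerivative 𝓘(ℝ, F) F (fun p : M ↦ TangentSpace 𝓘(ℝ, F) p))
    (f : (p : M) → TangentSpace 𝓘(ℝ, F) p →L[ℝ] TangentSpace 𝓘(ℝ, F) p) : Prop :=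
  ∀ X : (p : M) → TangentSpace 𝓘(ℝ, F) p, IsSmoothVectorField X →
    ∀ p : M, compositionTensor nabla f X X p = 0

end Manifolds

/-! ### Homogeneous reductive spaces -/

section Homogeneous

variable {E : Type*} [NormedAddCommGroup E] [NormedSpace ℝ E]
  {G : Type*} [TopologicalSpace G] [ChartedSpace E G] [Group G]

/-- The adjoint action `Ad h` on the Lie algebra of `G`: the derivative at `1` of
`x ↦ h x h⁻¹`. -/
def groupAd (h : G) : GroupLieAlgebra 𝓘(ℝ, E) G →L[ℝ] GroupLieAlgebra 𝓘(ℝ, E) G :=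
  mfderiv 𝓘(ℝ, E) 𝓘(ℝ, E) (fun x : G ↦ h * x * h⁻¹) 1

/-- `γ` is a curve in `G` with `γ 0 = 1` and `γ' 0 = X`. -/
def HasVelocityAtOne (γ : ℝ → G) (X : GroupLieAlgebra 𝓘(ℝ, E) G) : Prop :=
  γ 0 = 1 ∧ HasMFDerivAt 𝓘(ℝ, ℝ) 𝓘(ℝ, E) γ 0 (ContinuousLinearMap.toSpanSingleton (M₁ := E) ℝ X)

/-- The derivative of the multiplication at `(1, 1)` is `(X, Y) ↦ X + Y`. -/
theorem mfderiv_mul_apply_of_eq_one [LieGroup 𝓘(ℝ, E) ∞ G] (a b : G) (ha : a = 1) (hb : b = 1)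
    (X Y : E) :
    (mfderiv (𝓘(ℝ, E).prod 𝓘(ℝ, E)) 𝓘(ℝ, E) (fun p : G × G ↦ p.1 * p.2) (a, b) (X, Y) : E) =
      X + Y := by
  subst ha hb
  have hmul : MDifferentiableAt (𝓘(ℝ, E).prod 𝓘(ℝ, E)) 𝓘(ℝ, E)
      (fun p : G × G ↦ p.1 * p.2) (1, 1) :=
    (contMDiff_mul 𝓘(ℝ, E) ∞).mdifferentiable (by simp) _
  refine (mfderiv_prod_eq_add_apply (v := (X, Y)) hmul).trans ?_
  have h1 : (fun z : G ↦ z * 1) = id := by ext; simp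
  have h2 : (fun z : G ↦ 1 * z) = id := by ext; simp
  change (mfderiv 𝓘(ℝ, E) 𝓘(ℝ, E) (fun z : G ↦ z * 1) 1 X : E) +
    (mfderiv 𝓘(ℝ, E) 𝓘(ℝ, E) (fun z : G ↦ 1 * z) 1 Y : E) = X + Y
  rw [h1, h2, mfderiv_id]
  rfl

/-- The Lie algebra of a closed subgroup `H`, as a subspace of the Lie algebra of `G`: the
velocities at `1` of the curves in `H`. (As `H` is closed, these are exactly the `X` with
`exp (t X) ∈ H` for all real `t`.) -/
def subgroupLieAlgebra [LieGroup 𝓘(ℝ, E) ∞ G] (H : Subgroup G) :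
    Submodule ℝ (GroupLieAlgebra 𝓘(ℝ, E) G) where
  carrier := {X | ∃ γ : ℝ → G, (∀ t, γ t ∈ H) ∧ HasVelocityAtOne γ X}
  zero_mem' := by
    refine ⟨fun _ ↦ 1, fun _ ↦ H.one_mem, rfl, ?_⟩
    refine (hasMFDerivAt_const (I := 𝓘(ℝ, ℝ)) (I' := 𝓘(ℝ, E)) (1 : G) (0 : ℝ)).congr_mfderiv ?_
    exact (ContinuousLinearMap.toSpanSingleton_zero (M₁ := E) ℝ).symm
  add_mem' := by
    rintro X Y ⟨γ, hγH, hγ0, hγ⟩ ⟨δ, hδH, hδ0, hδ⟩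
    refine ⟨fun t ↦ γ t * δ t, fun t ↦ H.mul_mem (hγH t) (hδH t), by simp [hγ0, hδ0], ?_⟩
    have hmul : MDifferentiableAt (𝓘(ℝ, E).prod 𝓘(ℝ, E)) 𝓘(ℝ, E)
        (fun p : G × G ↦ p.1 * p.2) (γ 0, δ 0) :=
      (contMDiff_mul 𝓘(ℝ, E) ∞).mdifferentiable (by simp) _
    have h := hmul.hasMFDerivAt.comp (0 : ℝ) (hγ.prodMk hδ)
    refine h.congr_mfderiv ?_
    refine ContinuousLinearMap.ext fun r : ℝ ↦ ?_
    refine (mfderiv_mul_apply_of_eq_one (E := E) _ _ hγ0 hδ0 (r • X) (r • Y)).trans ?_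
    exact (smul_add r X Y).symm
  smul_mem' := by
    rintro c X ⟨γ, hγH, hγ0, hγ⟩
    refine ⟨fun t ↦ γ (c * t), fun t ↦ hγH _, by simp [hγ0], ?_⟩
    have hc : HasMFDerivAt 𝓘(ℝ, ℝ) 𝓘(ℝ, ℝ) (fun t : ℝ ↦ c * t) 0
        (c • ContinuousLinearMap.id ℝ ℝ) := by
      refine HasFDerivAt.hasMFDerivAt ?_
      exact (hasFDerivAt_id (0 : ℝ)).const_mul c
    have hγ' : HasMFDerivAt 𝓘(ℝ, ℝ) 𝓘(ℝ, E) γ (c * 0)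
        (ContinuousLinearMap.toSpanSingleton (M₁ := E) ℝ X) := by
      rw [mul_zero]; exact hγ
    refine (hγ'.comp (0 : ℝ) hc).congr_mfderiv ?_
    refine ContinuousLinearMap.ext fun r : ℝ ↦ ?_
    change (c * r) • (X : E) = r • (c • (X : E))
    rw [smul_smul, mul_comm]

/-- A smooth Lie group is in particular of the regularity `C^3` for which Mathlib defines the Lie
bracket on the tangent space at `1`. -/
instance lieGroup_minSmoothness_three [LieGroup 𝓘(ℝ, E) ∞ G] :
    LieGroup 𝓘(ℝ, E) (minSmoothness ℝ 3) G :=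
  LieGroup.of_le (n := ∞) (by rw [minSmoothness_of_isRCLikeNormedField]; exact ENat.LEInfty.out)

/-- `W` is an `Ad(H)`-invariant subspace of the Lie algebra of `G`. -/
def IsAdInvariant (H : Subgroup G) (W : Submodule ℝ (GroupLieAlgebra 𝓘(ℝ, E) G)) : Prop :=
  ∀ h ∈ H, ∀ x ∈ W, groupAd h x ∈ W

/-- `W` is an irreducible `Ad(H)`-submodule. -/
def IsAdIrreducible (H : Subgroup G) (W : Submodule ℝ (GroupLieAlgebra 𝓘(ℝ, E) G)) : Prop :=
  IsAdInvariant H W ∧ W ≠ ⊥ ∧ ∀ V ≤ W, IsAdInvariant H V → V = ⊥ ∨ V = W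

/-- `V` and `W` are equivalent `Ad(H)`-modules. -/
def AreAdEquivalent (H : Subgroup G) (V W : Submodule ℝ (GroupLieAlgebra 𝓘(ℝ, E) G)) : Prop :=
  ∃ φ : V ≃ₗ[ℝ] W, ∀ h ∈ H, ∀ x y : V,
    (y : GroupLieAlgebra 𝓘(ℝ, E) G) = groupAd h (x : GroupLieAlgebra 𝓘(ℝ, E) G) →
      (φ y : GroupLieAlgebra 𝓘(ℝ, E) G) = groupAd h (φ x : GroupLieAlgebra 𝓘(ℝ, E) G)

/-- The conditions on the reductive decomposition `𝔤 = 𝔥 ⊕ 𝔪`, `𝔪 = 𝔪₀ ⊕ 𝔪₁ ⊕ 𝔪₂`, of a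
homogeneous space `G/H` of a semisimple Lie group; indices are taken modulo `3`. -/
structure IsThreeSummandReductive [CompleteSpace E] [LieGroup 𝓘(ℝ, E) ∞ G]
    (H : Subgroup G) (𝔪 : Submodule ℝ (GroupLieAlgebra 𝓘(ℝ, E) G))
    (m : Fin 3 → Submodule ℝ (GroupLieAlgebra 𝓘(ℝ, E) G)) : Prop where
  semisimple : LieAlgebra.IsSemisimple ℝ (GroupLieAlgebra 𝓘(ℝ, E) G)
  isCompl : IsCompl (subgroupLieAlgebra H) 𝔪
  invariant : IsAdInvariant H 𝔪
  independent : iSupIndep m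
  iSup_eq : ⨆ i, m i = 𝔪
  irreducible : ∀ i, IsAdIrreducible H (m i)
  inequivalent : ∀ i j, i ≠ j → ¬ AreAdEquivalent H (m i) (m j)
  orthogonal : ∀ i j, i ≠ j → ∀ x ∈ m i, ∀ y ∈ m j,
    killingForm ℝ (GroupLieAlgebra 𝓘(ℝ, E) G) x y = 0
  bracket_ne : ∀ i, ∃ x ∈ m i, ∃ y ∈ m (i + 1), ⁅x, y⁆ ≠ 0
  bracket_mem : ∀ i, ∀ x ∈ m i, ∀ y ∈ m (i + 1), ⁅x, y⁆ ∈ m (i + 2)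
  bracket_self_mem : ∀ i, ∀ x ∈ m i, ∀ y ∈ m i, ⁅x, y⁆ ∈ subgroupLieAlgebra H

section Quotient

variable {H : Subgroup G}
  {F : Type*} [NormedAddCommGroup F] [NormedSpace ℝ F] [ChartedSpace F (G ⧸ H)]

/-- The derivative `dτ(a)` at `p` of the translation `τ(a) : x H ↦ a x H` of `G/H`. -/
def dTranslation (a : G) (p : G ⧸ H) :
    TangentSpace 𝓘(ℝ, F) p →L[ℝ] TangentSpace 𝓘(ℝ, F) (a • p) :=
  mfderiv 𝓘(ℝ, F) 𝓘(ℝ, F) (fun q : G ⧸ H ↦ a • q) p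

/-- The derivative at `1` of the projection `G → G/H`. Restricted to a reductive complement it
is the identification of the latter with the tangent space of `G/H` at the base point `o = H`. -/
def dProjection (H : Subgroup G) [ChartedSpace F (G ⧸ H)] :
    GroupLieAlgebra 𝓘(ℝ, E) G →L[ℝ] TangentSpace 𝓘(ℝ, F) ((1 : G) : G ⧸ H) :=
  mfderiv 𝓘(ℝ, E) 𝓘(ℝ, F) (fun x : G ↦ (x : G ⧸ H)) 1

/-- The affinor `f` on `G/H` is `G`-invariant. -/
def IsInvariantAffinor
    (f : (p : G ⧸ H) → TangentSpace 𝓘(ℝ, F) p →L[ℝ] TangentSpace 𝓘(ℝ, F) p) : Prop :=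
  ∀ (a : G) (p : G ⧸ H) (v : TangentSpace 𝓘(ℝ, F) p),
    dTranslation a p (f p v) = f (a • p) (dTranslation a p v)

/-- The Riemannian metric `g` on `G/H` is `G`-invariant. -/
def IsInvariantMetric [IsManifold 𝓘(ℝ, F) ∞ (G ⧸ H)]
    (g : Bundle.ContMDiffRiemannianMetric 𝓘(ℝ, F) ∞ F
      (fun p : G ⧸ H ↦ TangentSpace 𝓘(ℝ, F) p)) : Prop :=
  ∀ (a : G) (p : G ⧸ H) (v w : TangentSpace 𝓘(ℝ, F) p),
    g.inner (a • p) (dTranslation a p v) (dTranslation a p w) = g.inner p v w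

/-- At the base point `f` is an almost complex structure `J` on the summand `m i`, and zero on
the other summands. -/
def IsComplexOnSummand (m : Fin 3 → Submodule ℝ (GroupLieAlgebra 𝓘(ℝ, E) G)) (i : Fin 3)
    (f : (p : G ⧸ H) → TangentSpace 𝓘(ℝ, F) p →L[ℝ] TangentSpace 𝓘(ℝ, F) p) : Prop :=
  (∃ J : m i →ₗ[ℝ] m i, (∀ x, J (J x) = -x) ∧
    ∀ x : m i, f ((1 : G) : G ⧸ H) (dProjection H (x : GroupLieAlgebra 𝓘(ℝ, E) G)) =
      dProjection H (J x : GroupLieAlgebra 𝓘(ℝ, E) G)) ∧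
  ∀ j, j ≠ i → ∀ x ∈ m j, f ((1 : G) : G ⧸ H) (dProjection H x) = 0

end Quotient

end Homogeneous

end

/-! # Invariant `f`-structures on homogeneous spaces with three isotropy summands

Write `A^*` for the fundamental vector field on `G/H` of `A` in the Lie algebra. An invariant metric
and an invariant affinor have vanishing Lie derivatives along `A^*`. As `∇` is torsion-free, this
turns the covariant derivative of `f` into `∇_X (f) Y = ∇_{f Y} A^* - f (∇_Y A^*)` at any point
where `X = A^*` (`IsSmoothAction.nablaAffinor_eq`), and Koszul's formula expresses
`g(∇_{B^*} A^*, C^*)` by brackets in the Lie algebra alone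
(`IsSmoothAction.two_mul_metric_nabla_fundamentalField`).

Different summands `m i` are orthogonal for `g` by Schur's lemma
(`bilinForm_eq_zero_of_not_areAdEquivalent`). Hence `∇_{y^*} x^* = 0` at the base point for
`x, y ∈ m i`, because `[m i, m i]` acts trivially there and the brackets of `m i` with the other
summands are orthogonal to it (`nabla_fundamentalField_eq_zero`). As `f` takes values in `m i`,
the structure is nearly Kähler. On the other hand, a Killing `f`-structure would force the brackets
of the other two summands to be orthogonal to `m i` (`metric_eq_zero_of_isKillingF`), while these
brackets lie in `m i` and do not all vanish.

The Lie derivatives are computed without flows. For a curve `c` through `1` with velocity `A`, the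
bracket `[A^*, Y]` at `o` is the derivative at `t = 0` of the pull-back of `Y` to `o` under the
translation by `c t` (`IsSmoothAction.hasDerivAt_mlieBracket_fundamentalField`). The infinitesimal
invariance of `f` and `g` is read off from this, and so is the bracket of two fundamental fields.
The derivative of `Ad` comes from the same principle, for the right translations of `G`
(`hasDerivAt_groupAd`).

On the side of the homogeneous space, local sections of the submersion `G → G/H` show that the
action is smooth and that the kernel of `𝔤 → T_o (G/H)` is the Lie algebra of `H`. A point `a • o`
is treated like `o` by passing to the action of `G` by the conjugates `a * x * a⁻¹`. -/

/-! ### Lie brackets as derivatives along a family of maps -/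

section Flow

open Filter VectorField
open scoped Topology

variable {F : Type*} [NormedAddCommGroup F] [NormedSpace ℝ F] [CompleteSpace F]

/-- Let `K (t, ·)` be a family of maps with `K (0, ·) = id` and velocity field `v` at `t = 0`.
If `η t` is the pull-back of the vector `y (K (t, e₀))` along `K (t, ·)`, then the derivative of
`η` at `0` is the Lie bracket of `v` and `y` at `e₀`. The family need not be a flow. -/
theorem hasDerivAt_lieBracket_of_fderiv_apply_eq {K : ℝ × F → F} {e₀ : F}
    (hK : ContDiffAt ℝ 2 K (0, e₀)) (hK0 : ∀ᶠ e in 𝓝 e₀, K (0, e) = e)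
    {v y : F → F} (hv : ∀ᶠ e in 𝓝 e₀, v e = fderiv ℝ K (0, e) (1, 0))
    (hy : DifferentiableAt ℝ y e₀) {η : ℝ → F}
    (hη : ∀ᶠ t in 𝓝 (0 : ℝ), fderiv ℝ K (t, e₀) (0, η t) = y (K (t, e₀))) :
    HasDerivAt η (lieBracket ℝ v y e₀) 0 := by
  have hdK : DifferentiableAt ℝ (fderiv ℝ K) (0, e₀) :=
    (hK.fderiv_right (m := 1) (by norm_num)).differentiableAt (by norm_num)
  have hKd : DifferentiableAt ℝ K (0, e₀) := hK.differentiableAt (by norm_num)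
  have hsymm : IsSymmSndFDerivAt ℝ K (0, e₀) := hK.isSymmSndFDerivAt (by simp)
  set K2 := fderiv ℝ (fderiv ℝ K) (0, e₀)
  have hcurve : HasDerivAt (fun t : ℝ ↦ (t, e₀)) (1, 0) 0 :=
    (hasDerivAt_id (0 : ℝ)).prodMk (hasDerivAt_const _ _)
  have hslice : HasFDerivAt (fun e : F ↦ ((0 : ℝ), e)) (ContinuousLinearMap.inr ℝ ℝ F) e₀ :=
    hasFDerivAt_prodMk_right _ _
  -- the derivative of `K (t, ·)` at `e₀`, as a curve of operators
  let D : ℝ → F →L[ℝ] F := fun t ↦ (fderiv ℝ K (t, e₀)).comp (ContinuousLinearMap.inr ℝ ℝ F)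
  have hD : HasDerivAt D ((K2 (1, 0)).comp (ContinuousLinearMap.inr ℝ ℝ F)) 0 := by
    have h1 : HasDerivAt (fun t : ℝ ↦ fderiv ℝ K (t, e₀)) (K2 (1, 0)) 0 :=
      hdK.hasFDerivAt.comp_hasDerivAt (0 : ℝ) hcurve
    exact (((ContinuousLinearMap.compL ℝ F (ℝ × F) F).flip
      (ContinuousLinearMap.inr ℝ ℝ F)).hasFDerivAt.comp_hasDerivAt (0 : ℝ) h1)
  have hD0 : D 0 = 1 := by
    have h1 : HasFDerivAt (fun e ↦ K (0, e)) (D 0) e₀ := hKd.hasFDerivAt.comp e₀ hslice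
    have h2 : HasFDerivAt (fun e ↦ K (0, e)) (ContinuousLinearMap.id ℝ F) e₀ :=
      (hasFDerivAt_id e₀).congr_of_eventuallyEq hK0
    exact h1.unique h2
  -- by the symmetry of second derivatives, `D` and `v` have the same derivative
  have hv' : fderiv ℝ v e₀ = (K2 (1, 0)).comp (ContinuousLinearMap.inr ℝ ℝ F) := by
    have h1 : HasFDerivAt (fun e ↦ fderiv ℝ K (0, e) (1, 0))
        ((ContinuousLinearMap.apply ℝ F ((1, 0) : ℝ × F)).comp
          (K2.comp (ContinuousLinearMap.inr ℝ ℝ F))) e₀ :=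
      (ContinuousLinearMap.apply ℝ F ((1, 0) : ℝ × F)).hasFDerivAt.comp e₀
        (hdK.hasFDerivAt.comp e₀ hslice)
    rw [(h1.congr_of_eventuallyEq hv).fderiv]
    ext w
    exact hsymm _ _
  have hyK : HasDerivAt (fun t ↦ y (K (t, e₀))) (fderiv ℝ y e₀ (v e₀)) 0 := by
    have h1 : HasDerivAt (fun t ↦ K (t, e₀)) (v e₀) 0 := by
      rw [hv.self_of_nhds]
      exact hKd.hasFDerivAt.comp_hasDerivAt (0 : ℝ) hcurve
    have h2 : HasFDerivAt y (fderiv ℝ y e₀) (K (0, e₀)) := by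
      rw [hK0.self_of_nhds]; exact hy.hasFDerivAt
    exact h2.comp_hasDerivAt (0 : ℝ) h1
  have hinv : HasDerivAt (fun t ↦ Ring.inverse (D t))
      (-((K2 (1, 0)).comp (ContinuousLinearMap.inr ℝ ℝ F))) 0 := by
    have h1 := hasFDerivAt_ringInverse (𝕜 := ℝ) (1 : (F →L[ℝ] F)ˣ)
    rw [Units.val_one, ← hD0] at h1
    have h2 := h1.comp_hasDerivAt (0 : ℝ) hD
    refine h2.congr_deriv ?_
    simp
  have hunit : ∀ᶠ t in 𝓝 (0 : ℝ), IsUnit (D t) := by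
    refine hD.continuousAt.eventually ?_
    rw [hD0]
    exact Units.isOpen.mem_nhds isUnit_one
  have hηeq : η =ᶠ[𝓝 0] fun t ↦ Ring.inverse (D t) (y (K (t, e₀))) := by
    filter_upwards [hunit, hη] with t ht hηt
    rw [← hηt]
    have h1 : Ring.inverse (D t) (D t (η t)) = η t := by
      rw [← mul_apply_eq_comp, Ring.inverse_mul_cancel _ ht,
        one_apply_eq_self]
    exact h1.symm
  have key := (hinv.clm_apply hyK).congr_of_eventuallyEq hηeq
  refine key.congr_deriv ?_
  simp only [lieBracket_eq, hv', hD0, Ring.inverse_one, hK0.self_of_nhds,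
    neg_apply, one_apply_eq_self]
  abel

variable {M : Type*} [TopologicalSpace M] [ChartedSpace F M] [IsManifold 𝓘(ℝ, F) ∞ M]

/-- The version on a manifold of `hasDerivAt_lieBracket_of_fderiv_apply_eq`. The pulled back
vectors `η t` are tangent to `M` at the fixed point `o`, and are taken in the model space `F`. -/
theorem hasDerivAt_mlieBracket_of_mfderiv_apply_eq {φ : ℝ → M → M} {o : M}
    (hφ : ContMDiffAt (𝓘(ℝ, ℝ).prod 𝓘(ℝ, F)) 𝓘(ℝ, F) 2 (fun p : ℝ × M ↦ φ p.1 p.2) (0, o))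
    (hφ0 : ∀ q, φ 0 q = q) {V Y : (q : M) → TangentSpace 𝓘(ℝ, F) q}
    (hV : ∀ q, (V q : F) = mfderiv 𝓘(ℝ, ℝ) 𝓘(ℝ, F) (fun t ↦ φ t q) 0 (1 : ℝ))
    (hY : MDifferentiableAt 𝓘(ℝ, F) 𝓘(ℝ, F).tangent
      (fun q ↦ (⟨q, Y q⟩ : TangentBundle 𝓘(ℝ, F) M)) o) {η : ℝ → F}
    (hη : ∀ᶠ t in 𝓝 (0 : ℝ), (mfderiv 𝓘(ℝ, F) 𝓘(ℝ, F) (φ t) o (η t) : F) = Y (φ t o)) :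
    HasDerivAt η (mlieBracket 𝓘(ℝ, F) V Y o : F) 0 := by
  have : IsManifold 𝓘(ℝ, F) 1 M := IsManifold.of_le (n := ∞) (by simp)
  have : IsManifold 𝓘(ℝ, F) 2 M := IsManifold.of_le (n := ∞) (by exact ENat.LEInfty.out)
  set ψ := extChartAt 𝓘(ℝ, F) o with hψ
  set e₀ : F := ψ o
  have hsrc : ψ.source ∈ 𝓝 o := extChartAt_source_mem_nhds o
  have htgt : ψ.target ∈ 𝓝 e₀ := extChartAt_target_mem_nhds o
  have hinv0 : ψ.symm e₀ = o := extChartAt_to_inv o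
  -- the derivative of the chart, as a family of endomorphisms of the model space
  let dψ : M → F →L[ℝ] F := fun q ↦ mfderiv 𝓘(ℝ, F) 𝓘(ℝ, F) ψ q
  have hdψ : ∀ q ∈ ψ.source, HasMFDerivAt 𝓘(ℝ, F) 𝓘(ℝ, F) ψ q (dψ q) := fun q hq ↦
    (mdifferentiableAt_extChartAt (by rwa [hψ, extChartAt_source] at hq)).hasMFDerivAt
  let K : ℝ × F → F := fun p ↦ ψ (φ p.1 (ψ.symm p.2))
  have hsymmC : ContMDiffAt 𝓘(ℝ, F) 𝓘(ℝ, F) 2 ψ.symm e₀ :=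
    (contMDiffOn_extChartAt_symm o).contMDiffAt htgt
  have hKC : ContDiffAt ℝ 2 K (0, e₀) := by
    have h1 : ContMDiffAt (𝓘(ℝ, ℝ).prod 𝓘(ℝ, F)) (𝓘(ℝ, ℝ).prod 𝓘(ℝ, F)) 2
        (fun p : ℝ × F ↦ (p.1, ψ.symm p.2)) (0, e₀) :=
      contMDiffAt_fst.prodMk (ContMDiffAt.comp (0, e₀) (g := ψ.symm) (f := Prod.snd)
        hsymmC contMDiffAt_snd)
    have h2 : ContMDiffAt (𝓘(ℝ, ℝ).prod 𝓘(ℝ, F)) 𝓘(ℝ, F) 2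
        (fun p : ℝ × F ↦ φ p.1 (ψ.symm p.2)) (0, e₀) := by
      refine ContMDiffAt.comp_of_eq (g := fun p : ℝ × M ↦ φ p.1 p.2) (y := (0, o)) hφ h1 ?_
      simp only [hinv0]
    have h3 : ContMDiffAt (𝓘(ℝ, ℝ).prod 𝓘(ℝ, F)) 𝓘(ℝ, F) 2 K (0, e₀) := by
      refine ContMDiffAt.comp_of_eq (g := ψ) (y := o) contMDiffAt_extChartAt h2 ?_
      simp only [hinv0, hφ0]
    rw [← contMDiffAt_iff_contDiffAt, modelWithCornersSelf_prod, ← chartedSpaceSelf_prod]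
    exact h3
  have hφev : ∀ᶠ p in 𝓝 ((0 : ℝ), o), ContMDiffAt (𝓘(ℝ, ℝ).prod 𝓘(ℝ, F)) 𝓘(ℝ, F) 2
      (fun p : ℝ × M ↦ φ p.1 p.2) p := by
    exact (contMDiffAt_iff_contMDiffAt_nhds (by simp)).1 hφ
  have hKev : ∀ᶠ p in 𝓝 ((0 : ℝ), e₀), DifferentiableAt ℝ K p :=
    (hKC.eventually (by simp)).mono fun p hp ↦ hp.differentiableAt (by norm_num)
  -- vector fields read in the chart
  let R : ((q : M) → TangentSpace 𝓘(ℝ, F) q) → F → F := fun X ↦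
    mpullbackWithin 𝓘(ℝ, F) 𝓘(ℝ, F) ψ.symm X (Set.range 𝓘(ℝ, F))
  have hcomp : ∀ X : (q : M) → TangentSpace 𝓘(ℝ, F) q, ∀ e ∈ ψ.target,
      R X e = dψ (ψ.symm e) (X (ψ.symm e)) := by
    intro X e he
    refine DFunLike.congr_fun ?_ (X (ψ.symm e))
    exact ContinuousLinearMap.inverse_eq
      (mfderivWithin_extChartAt_symm_comp_mfderiv_extChartAt he)
      (mfderiv_extChartAt_comp_mfderivWithin_extChartAt_symm he)
  have hbr : (mlieBracket 𝓘(ℝ, F) V Y o : F) =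
      lieBracket ℝ (fun e ↦ dψ (ψ.symm e) (V (ψ.symm e)))
        (fun e ↦ dψ (ψ.symm e) (Y (ψ.symm e))) e₀ := by
    have h1 : (mlieBracket 𝓘(ℝ, F) V Y o : F) =
        (dψ o).inverse
          (lieBracketWithin ℝ (R V) (R Y) (ψ.symm ⁻¹' Set.univ ∩ Set.range 𝓘(ℝ, F)) e₀) := rfl
    have h2 : dψ o = ContinuousLinearMap.id ℝ F :=
      mfderiv_extChartAt_self
    have h3 : ψ.symm ⁻¹' Set.univ ∩ Set.range 𝓘(ℝ, F) = Set.univ := by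
      rw [Set.preimage_univ, Set.univ_inter, ModelWithCorners.range_eq_univ]
    rw [h1, h2, ContinuousLinearMap.inverse_id, h3, lieBracketWithin_univ]
    exact Filter.EventuallyEq.lieBracket_vectorField_eq (E := F)
      (Filter.eventually_of_mem htgt (hcomp V)) (Filter.eventually_of_mem htgt (hcomp Y))
  rw [hbr]
  refine hasDerivAt_lieBracket_of_fderiv_apply_eq hKC ?_ ?_ ?_ ?_
  · filter_upwards [htgt] with e he
    simp only [K, hφ0]
    exact ψ.right_inv he
  · have hin : Tendsto (fun e : F ↦ ((0 : ℝ), e)) (𝓝 e₀) (𝓝 (0, e₀)) := by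
      exact (Continuous.prodMk_right (0 : ℝ)).tendsto e₀
    have hin' : Tendsto (fun e : F ↦ ((0 : ℝ), ψ.symm e)) (𝓝 e₀) (𝓝 (0, o)) := by
      have := hsymmC.continuousAt
      rw [ContinuousAt, hinv0] at this
      exact tendsto_const_nhds.prodMk_nhds this
    filter_upwards [htgt, hin.eventually hKev, hin'.eventually hφev] with e he hKe hφe
    have hq : ψ.symm e ∈ ψ.source := ψ.map_target he
    have h1 : HasMFDerivAt 𝓘(ℝ, ℝ) 𝓘(ℝ, F) (fun t ↦ φ t (ψ.symm e)) 0
        (mfderiv 𝓘(ℝ, ℝ) 𝓘(ℝ, F) (fun t ↦ φ t (ψ.symm e)) 0) := by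
      refine MDifferentiableAt.hasMFDerivAt (ContMDiffAt.mdifferentiableAt (n := 2) ?_ (by simp))
      exact ContMDiffAt.comp (0 : ℝ) (g := fun p : ℝ × M ↦ φ p.1 p.2)
        (f := fun t : ℝ ↦ (t, ψ.symm e)) hφe (contMDiffAt_id.prodMk contMDiffAt_const)
    have h2 : HasMFDerivAt 𝓘(ℝ, F) 𝓘(ℝ, F) ψ (φ 0 (ψ.symm e)) (dψ (φ 0 (ψ.symm e))) :=
      hdψ _ (by rwa [hφ0])
    have h3 : HasDerivAt (fun t ↦ K (t, e)) (dψ (φ 0 (ψ.symm e)) (V (ψ.symm e))) 0 := by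
      have h4 : HasFDerivAt (fun t ↦ K (t, e)) (dψ (φ 0 (ψ.symm e)) ∘L
          (mfderiv 𝓘(ℝ, ℝ) 𝓘(ℝ, F) (fun t ↦ φ t (ψ.symm e)) 0 : ℝ →L[ℝ] F)) 0 :=
        (h2.comp (0 : ℝ) h1).hasFDerivAt
      rw [hV]
      exact h4.hasDerivAt
    have hc : HasDerivAt (fun t : ℝ ↦ (t, e)) (1, 0) 0 :=
      (hasDerivAt_id (0 : ℝ)).prodMk (hasDerivAt_const _ _)
    have h4 : HasDerivAt (fun t ↦ K (t, e)) (fderiv ℝ K (0, e) (1, 0)) 0 :=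
      HasFDerivAt.comp_hasDerivAt (l := K) (f := fun t : ℝ ↦ (t, e)) (0 : ℝ) hKe.hasFDerivAt hc
    rw [hφ0] at h3
    exact h3.unique h4
  · have h1 : DifferentiableWithinAt ℝ (R Y) (ψ.symm ⁻¹' Set.univ ∩ Set.range 𝓘(ℝ, F)) e₀ :=
      (hY.mdifferentiableWithinAt (s := Set.univ)).differentiableWithinAt_mpullbackWithin_vectorField
    have h2 : ψ.symm ⁻¹' Set.univ ∩ Set.range 𝓘(ℝ, F) = Set.univ := by
      rw [Set.preimage_univ, Set.univ_inter, ModelWithCorners.range_eq_univ]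
    rw [h2, differentiableWithinAt_univ] at h1
    exact h1.congr_of_eventuallyEq
      (Filter.eventually_of_mem htgt fun e he ↦ (hcomp Y e he).symm)
  · have hin : Tendsto (fun t : ℝ ↦ (t, e₀)) (𝓝 0) (𝓝 (0, e₀)) :=
      (Continuous.prodMk_left e₀).tendsto (0 : ℝ)
    have hin' : Tendsto (fun t : ℝ ↦ (t, o)) (𝓝 0) (𝓝 (0, o)) :=
      (Continuous.prodMk_left o).tendsto (0 : ℝ)
    have hφs : ∀ᶠ t in 𝓝 (0 : ℝ), φ t o ∈ ψ.source := by
      have h1 : ContinuousAt (fun t ↦ φ t o) 0 :=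
        ContinuousAt.comp (x := (0 : ℝ)) (g := fun p : ℝ × M ↦ φ p.1 p.2)
          (f := fun t : ℝ ↦ (t, o)) hφ.continuousAt hin'
      refine h1.eventually_mem ?_
      rw [hφ0]
      exact hsrc
    filter_upwards [hη, hin.eventually hKev, hin'.eventually hφev, hφs] with t hηt hKt hφt hst
    have h0 : HasMFDerivAt 𝓘(ℝ, F) 𝓘(ℝ, F) ψ.symm e₀ (ContinuousLinearMap.id ℝ F) := by
      have h1 : HasMFDerivAt 𝓘(ℝ, F) 𝓘(ℝ, F) ψ.symm e₀ (mfderiv 𝓘(ℝ, F) 𝓘(ℝ, F) ψ.symm e₀) :=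
        (hsymmC.mdifferentiableAt (by simp)).hasMFDerivAt
      have h2 := mfderivWithin_range_extChartAt_symm (I := 𝓘(ℝ, F)) (x := o)
      rw [ModelWithCorners.range_eq_univ, mfderivWithin_univ] at h2
      exact h1.congr_mfderiv h2
    have h1 : HasMFDerivAt 𝓘(ℝ, F) 𝓘(ℝ, F) (φ t) (ψ.symm e₀)
        (mfderiv 𝓘(ℝ, F) 𝓘(ℝ, F) (φ t) (ψ.symm e₀)) := by
      refine MDifferentiableAt.hasMFDerivAt (ContMDiffAt.mdifferentiableAt (n := 2) ?_ (by simp))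
      rw [hinv0]
      exact ContMDiffAt.comp o (g := fun p : ℝ × M ↦ φ p.1 p.2)
        (f := fun q : M ↦ (t, q)) hφt (contMDiffAt_const.prodMk contMDiffAt_id)
    have h2 : HasMFDerivAt 𝓘(ℝ, F) 𝓘(ℝ, F) ψ (φ t (ψ.symm e₀)) (dψ (φ t (ψ.symm e₀))) :=
      hdψ _ (by rwa [hinv0])
    have h3 : HasFDerivAt (fun e ↦ K (t, e)) (dψ (φ t (ψ.symm e₀)) ∘L
        (mfderiv 𝓘(ℝ, F) 𝓘(ℝ, F) (φ t) (ψ.symm e₀) : F →L[ℝ] F)) e₀ :=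
      (h2.comp e₀ (h1.comp e₀ h0)).hasFDerivAt
    have h4 : HasFDerivAt (fun e ↦ K (t, e))
        ((fderiv ℝ K (t, e₀)) ∘L (ContinuousLinearMap.inr ℝ ℝ F)) e₀ :=
      hKt.hasFDerivAt.comp e₀ (hasFDerivAt_prodMk_right _ _)
    have h5 := DFunLike.congr_fun (h4.unique h3) (η t)
    have h6 : ψ.symm (K (t, e₀)) = φ t o := by
      simp only [K, hinv0]
      exact ψ.left_inv hst
    refine h5.trans ?_
    rw [h6, hinv0, ← hηt]
    rfl

end Flow

/-! ### Smooth actions and their fundamental vector fields -/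

section SmoothAction

open Filter VectorField
open scoped Topology

variable {E : Type*} [NormedAddCommGroup E] [NormedSpace ℝ E]
  {G : Type*} [TopologicalSpace G] [ChartedSpace E G] [Group G]
  {F : Type*} [NormedAddCommGroup F] [NormedSpace ℝ F]
  {M : Type*} [TopologicalSpace M] [ChartedSpace F M]

variable (E F) in
/-- `act` is a smooth left action of the Lie group `G` on the manifold `M`. It is a bare function
and not a `MulAction`, because the action by conjugates `(x, q) ↦ (a * x * a⁻¹) • q` is used next
to the given one. -/
structure IsSmoothAction (act : G → M → M) : Prop where
  one : ∀ q, act 1 q = q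
  mul : ∀ x y q, act (x * y) q = act x (act y q)
  smooth : ContMDiff (𝓘(ℝ, E).prod 𝓘(ℝ, F)) 𝓘(ℝ, F) ∞ (fun p : G × M ↦ act p.1 p.2)

/-- The infinitesimal action at `q`: the derivative at `1` of the orbit map `x ↦ act x q`.
Its target is the tangent space at `act 1 q`, which is `q` for an action. -/
noncomputable def infinitesimalAction (act : G → M → M) (q : M) :
    GroupLieAlgebra 𝓘(ℝ, E) G →L[ℝ] TangentSpace 𝓘(ℝ, F) q :=
  mfderiv 𝓘(ℝ, E) 𝓘(ℝ, F) (fun x ↦ act x q) 1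

/-- The fundamental vector field of the action that belongs to the vector `A` of the Lie
algebra. -/
noncomputable def fundamentalField (act : G → M → M) (A : GroupLieAlgebra 𝓘(ℝ, E) G) (q : M) :
    TangentSpace 𝓘(ℝ, F) q :=
  infinitesimalAction act q A

theorem exists_contMDiffAt_hasVelocityAtOne [LieGroup 𝓘(ℝ, E) ∞ G]
    (A : GroupLieAlgebra 𝓘(ℝ, E) G) :
    ∃ c : ℝ → G, HasVelocityAtOne c A ∧ ContMDiffAt 𝓘(ℝ, ℝ) 𝓘(ℝ, E) ∞ c 0 := by
  have : IsManifold 𝓘(ℝ, E) 1 G := IsManifold.of_le (n := ∞) (by simp)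
  set χ := extChartAt 𝓘(ℝ, E) (1 : G)
  have hsymm : ContMDiffAt 𝓘(ℝ, E) 𝓘(ℝ, E) ∞ χ.symm (χ 1) :=
    (contMDiffOn_extChartAt_symm (1 : G)).contMDiffAt (extChartAt_target_mem_nhds 1)
  have hinv : χ.symm (χ 1) = 1 := extChartAt_to_inv _
  let A' : E := A
  let l : ℝ → E := fun t ↦ χ 1 + t • A'
  have hl0 : l 0 = χ 1 := by simp [l]
  have hl : ContMDiff 𝓘(ℝ, ℝ) 𝓘(ℝ, E) ∞ l := by
    rw [contMDiff_iff_contDiff]; fun_prop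
  have hld : HasMFDerivAt 𝓘(ℝ, ℝ) 𝓘(ℝ, E) l 0
      (ContinuousLinearMap.toSpanSingleton (M₁ := E) ℝ A') := by
    refine HasFDerivAt.hasMFDerivAt ?_
    exact (((hasDerivAt_id (0 : ℝ)).smul_const A').const_add (χ 1)).hasFDerivAt.congr_fderiv
      (by ext; simp)
  refine ⟨fun t ↦ χ.symm (l t), ⟨by simp [hl0, hinv], ?_⟩, ?_⟩
  · have h1 : HasMFDerivAt 𝓘(ℝ, E) 𝓘(ℝ, E) χ.symm (l 0) (ContinuousLinearMap.id ℝ E) := by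
      rw [hl0]
      have h2 := (hsymm.mdifferentiableAt (by simp)).hasMFDerivAt
      have h3 := mfderivWithin_range_extChartAt_symm (I := 𝓘(ℝ, E)) (x := (1 : G))
      rw [ModelWithCorners.range_eq_univ, mfderivWithin_univ] at h3
      exact h2.congr_mfderiv h3
    exact h1.comp (0 : ℝ) hld
  · exact ContMDiffAt.comp_of_eq (g := χ.symm) (y := χ 1) hsymm hl.contMDiffAt hl0

namespace IsSmoothAction

variable {act : G → M → M}

theorem contMDiff_left (h : IsSmoothAction E F act) (x : G) :
    ContMDiff 𝓘(ℝ, F) 𝓘(ℝ, F) ∞ (act x) :=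
  h.smooth.comp (contMDiff_const.prodMk contMDiff_id)

theorem contMDiff_orbit (h : IsSmoothAction E F act) (q : M) :
    ContMDiff 𝓘(ℝ, E) 𝓘(ℝ, F) ∞ (fun x ↦ act x q) :=
  h.smooth.comp (contMDiff_id.prodMk contMDiff_const)

theorem mdifferentiableAt_left (h : IsSmoothAction E F act) (x : G) (q : M) :
    MDifferentiableAt 𝓘(ℝ, F) 𝓘(ℝ, F) (act x) q :=
  (h.contMDiff_left x).mdifferentiable (by simp) q

theorem mdifferentiableAt_orbit (h : IsSmoothAction E F act) (x : G) (q : M) :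
    MDifferentiableAt 𝓘(ℝ, E) 𝓘(ℝ, F) (fun x ↦ act x q) x :=
  (h.contMDiff_orbit q).mdifferentiable (by simp) x

theorem act_inv_act (h : IsSmoothAction E F act) (x : G) (q : M) : act x⁻¹ (act x q) = q := by
  rw [← h.mul, inv_mul_cancel, h.one]

theorem act_act_inv (h : IsSmoothAction E F act) (x : G) (q : M) : act x (act x⁻¹ q) = q := by
  rw [← h.mul, mul_inv_cancel, h.one]

theorem mfderiv_act_mfderiv_act_inv (h : IsSmoothAction E F act) (x : G) (q : M) (v : F) :
    (mfderiv 𝓘(ℝ, F) 𝓘(ℝ, F) (act x) q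
      (mfderiv 𝓘(ℝ, F) 𝓘(ℝ, F) (act x⁻¹) (act x q) v : F) : F) = v := by
  have h1 := mfderiv_comp_apply_of_eq (I := 𝓘(ℝ, F)) (I' := 𝓘(ℝ, F)) (I'' := 𝓘(ℝ, F))
    (x := act x q) (y := q) (h.mdifferentiableAt_left x q)
    (h.mdifferentiableAt_left x⁻¹ (act x q)) (h.act_inv_act x q) v
  have h2 : act x ∘ act x⁻¹ = id := funext fun q ↦ h.act_act_inv x q
  rw [h2, mfderiv_id] at h1
  exact h1.symm

/-- Vector fields can be pulled back along the translations by the points of a curve. -/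
theorem exists_mfderiv_act_eq (h : IsSmoothAction E F act) (c : ℝ → G) (o : M)
    (Y : (q : M) → TangentSpace 𝓘(ℝ, F) q) :
    ∃ η : ℝ → F, ∀ t, (mfderiv 𝓘(ℝ, F) 𝓘(ℝ, F) (act (c t)) o (η t) : F) = Y (act (c t) o) :=
  ⟨fun t ↦ mfderiv 𝓘(ℝ, F) 𝓘(ℝ, F) (act (c t)⁻¹) (act (c t) o) (Y (act (c t) o)),
    fun t ↦ h.mfderiv_act_mfderiv_act_inv (c t) o (Y (act (c t) o))⟩

section

variable [LieGroup 𝓘(ℝ, E) ∞ G]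

/-- The translation by `x` carries the fundamental field of `B` to that of `Ad x B`. -/
theorem mfderiv_infinitesimalAction (h : IsSmoothAction E F act) (x : G) (q : M)
    (B : GroupLieAlgebra 𝓘(ℝ, E) G) :
    (mfderiv 𝓘(ℝ, F) 𝓘(ℝ, F) (act x) q (infinitesimalAction act q B) : F) =
      infinitesimalAction act (act x q) (groupAd x B) := by
  have hconj : MDifferentiableAt 𝓘(ℝ, E) 𝓘(ℝ, E) (fun y : G ↦ x * y * x⁻¹) 1 :=
    ((contMDiff_mul_right (I := 𝓘(ℝ, E)) (n := ∞) (a := x⁻¹)).comp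
      (contMDiff_mul_left (a := x))).mdifferentiable (by simp) 1
  have h1 := mfderiv_comp_apply_of_eq (I := 𝓘(ℝ, E)) (I' := 𝓘(ℝ, F)) (I'' := 𝓘(ℝ, F))
    (x := (1 : G)) (y := q) (g := act x) (f := fun y ↦ act y q)
    (h.mdifferentiableAt_left x q) (h.mdifferentiableAt_orbit 1 q) (h.one q) B
  have h2 := mfderiv_comp_apply_of_eq (I := 𝓘(ℝ, E)) (I' := 𝓘(ℝ, E)) (I'' := 𝓘(ℝ, F))
    (x := (1 : G)) (y := (1 : G)) (g := fun y ↦ act y (act x q)) (f := fun y ↦ x * y * x⁻¹)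
    (h.mdifferentiableAt_orbit 1 (act x q)) hconj (by simp) B
  have h3 : act x ∘ (fun y ↦ act y q) =
      (fun y ↦ act y (act x q)) ∘ (fun y ↦ x * y * x⁻¹) := by
    funext y
    simp only [Function.comp_apply, ← h.mul]
    congr 1
    group
  rw [h3] at h1
  exact h1.symm.trans h2

end

variable [IsManifold 𝓘(ℝ, F) ∞ M]

/-- Lie derivatives along a fundamental field are computed by pulling back along the action:
`[A^*, Y]_o = d/dt (dτ(c t)⁻¹ Y_{c t · o})` at `t = 0` for any curve `c` through `1` with
velocity `A`. -/
theorem hasDerivAt_mlieBracket_fundamentalField [CompleteSpace F] (h : IsSmoothAction E F act)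
    {A : GroupLieAlgebra 𝓘(ℝ, E) G} {c : ℝ → G} (hc : HasVelocityAtOne c A)
    (hcs : ContMDiffAt 𝓘(ℝ, ℝ) 𝓘(ℝ, E) ∞ c 0) {o : M}
    {Y : (q : M) → TangentSpace 𝓘(ℝ, F) q}
    (hY : MDifferentiableAt 𝓘(ℝ, F) 𝓘(ℝ, F).tangent
      (fun q ↦ (⟨q, Y q⟩ : TangentBundle 𝓘(ℝ, F) M)) o) {η : ℝ → F}
    (hη : ∀ t, (mfderiv 𝓘(ℝ, F) 𝓘(ℝ, F) (act (c t)) o (η t) : F) = Y (act (c t) o)) :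
    HasDerivAt η (mlieBracket 𝓘(ℝ, F) (fundamentalField act A) Y o : F) 0 := by
  obtain ⟨hc0, hcd⟩ := hc
  refine hasDerivAt_mlieBracket_of_mfderiv_apply_eq (φ := fun t q ↦ act (c t) q) ?_ ?_ ?_ hY
    (Eventually.of_forall hη)
  · refine ContMDiffAt.of_le (n := ∞) ?_ (by exact ENat.LEInfty.out)
    exact h.smooth.contMDiffAt.comp (0, o)
      ((ContMDiffAt.comp (0, o) (g := c) (f := Prod.fst) hcs contMDiffAt_fst).prodMk
        contMDiffAt_snd)
  · intro q
    rw [hc0, h.one]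
  · intro q
    have h1 : HasMFDerivAt 𝓘(ℝ, E) 𝓘(ℝ, F) (fun x ↦ act x q) (c 0)
        (infinitesimalAction act q : E →L[ℝ] F) := by
      rw [hc0]
      exact (h.mdifferentiableAt_orbit 1 q).hasMFDerivAt
    have h2 := DFunLike.congr_fun (h1.comp (0 : ℝ) hcd).mfderiv (1 : ℝ)
    refine Eq.trans ?_ h2.symm
    exact congrArg (infinitesimalAction act q) (one_smul ℝ (A : E)).symm

variable [LieGroup 𝓘(ℝ, E) ∞ G]

/-- A fundamental field is the composition of the zero section, a constant vector in the Lie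
algebra, and the tangent map of the action. -/
theorem contMDiff_fundamentalField (h : IsSmoothAction E F act) (A : GroupLieAlgebra 𝓘(ℝ, E) G) :
    IsSmoothVectorField (fundamentalField act A : (q : M) → TangentSpace 𝓘(ℝ, F) q) := by
  have : IsManifold 𝓘(ℝ, F) 1 M := IsManifold.of_le (n := ∞) (by simp)
  have : IsManifold 𝓘(ℝ, E) 1 G := IsManifold.of_le (n := ∞) (by simp)
  let fg : M → TangentBundle 𝓘(ℝ, F) M := fun q ↦ ⟨q, 0⟩
  have sfg : ContMDiff 𝓘(ℝ, F) 𝓘(ℝ, F).tangent ∞ fg := Bundle.contMDiff_zeroSection _ _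
  let fv : M → TangentBundle 𝓘(ℝ, E) G := fun _ ↦ ⟨1, A⟩
  have sfv : ContMDiff 𝓘(ℝ, F) 𝓘(ℝ, E).tangent ∞ fv := contMDiff_const
  have S₂ : ContMDiff (𝓘(ℝ, E).tangent.prod 𝓘(ℝ, F).tangent) (𝓘(ℝ, E).prod 𝓘(ℝ, F)).tangent ∞
    (equivTangentBundleProd 𝓘(ℝ, E) G 𝓘(ℝ, F) M).symm := contMDiff_equivTangentBundleProd_symm
  have S₃ : ContMDiff (𝓘(ℝ, E).prod 𝓘(ℝ, F)).tangent 𝓘(ℝ, F).tangent ∞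
      (tangentMap (𝓘(ℝ, E).prod 𝓘(ℝ, F)) 𝓘(ℝ, F) (fun p : G × M ↦ act p.1 p.2)) :=
    h.smooth.contMDiff_tangentMap (m := ∞) (by simp)
  have S := (S₃.comp S₂).comp (sfv.prodMk sfg)
  refine S.congr fun q ↦ ?_
  have hcongr : ∀ (q q' : M) (v w : F), q = q' → v = w →
      (⟨q, v⟩ : TangentBundle 𝓘(ℝ, F) M) = ⟨q', w⟩ := by
    rintro q _ v _ rfl rfl; rfl
  refine hcongr _ _ _ _ (h.one q).symm ?_
  have h1 := mfderiv_prod_eq_add_apply (I := 𝓘(ℝ, E)) (I' := 𝓘(ℝ, F)) (p := ((1 : G), q))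
    (v := ((A : E), (0 : F))) (h.smooth.mdifferentiable (by simp) (1, q))
  refine Eq.trans ?_ h1.symm
  refine (add_zero _).symm.trans ?_
  exact congrArg _ (map_zero (mfderiv 𝓘(ℝ, F) 𝓘(ℝ, F) (act (1 : G)) q)).symm

theorem mdifferentiableAt_fundamentalField (h : IsSmoothAction E F act)
    (A : GroupLieAlgebra 𝓘(ℝ, E) G) (q : M) :
    MDifferentiableAt 𝓘(ℝ, F) 𝓘(ℝ, F).tangent
      (fun q ↦ (⟨q, fundamentalField act A q⟩ : TangentBundle 𝓘(ℝ, F) M)) q :=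
  (h.contMDiff_fundamentalField A).mdifferentiable (by simp) q

end IsSmoothAction

section Adjoint

variable [LieGroup 𝓘(ℝ, E) ∞ G]

/-- The derivative of `Ad` at `1` is `ad`: for the family of right translations by `c t`, whose
velocity field is the left-invariant field of `A`, the pull-backs of the left-invariant field of
`B` are the vectors `Ad (c t) B`. -/
theorem hasDerivAt_groupAd [CompleteSpace E] {A : GroupLieAlgebra 𝓘(ℝ, E) G} {c : ℝ → G}
    (hc : HasVelocityAtOne c A) (hcs : ContMDiffAt 𝓘(ℝ, ℝ) 𝓘(ℝ, E) ∞ c 0)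
    (B : GroupLieAlgebra 𝓘(ℝ, E) G) :
    HasDerivAt (fun t ↦ (groupAd (c t) B : E)) (⁅A, B⁆ : GroupLieAlgebra 𝓘(ℝ, E) G) 0 := by
  obtain ⟨hc0, hcd⟩ := hc
  have hleft : ∀ x y : G, MDifferentiableAt 𝓘(ℝ, E) 𝓘(ℝ, E) (fun z : G ↦ x * z) y := fun x y ↦
    (contMDiff_mul_left (I := 𝓘(ℝ, E)) (n := ∞)).mdifferentiable (by simp) y
  have hright : ∀ x y : G, MDifferentiableAt 𝓘(ℝ, E) 𝓘(ℝ, E) (fun z : G ↦ z * x) y := fun x y ↦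
    (contMDiff_mul_right (I := 𝓘(ℝ, E)) (n := ∞)).mdifferentiable (by simp) y
  refine hasDerivAt_mlieBracket_of_mfderiv_apply_eq (φ := fun t x ↦ x * c t)
    (V := mulInvariantVectorField A) (Y := mulInvariantVectorField B) ?_ ?_ ?_
    (mdifferentiableAt_mulInvariantVectorField B) (Eventually.of_forall ?_)
  · refine ContMDiffAt.of_le (n := ∞) ?_ (by exact ENat.LEInfty.out)
    exact contMDiffAt_snd.mul
      (ContMDiffAt.comp ((0 : ℝ), (1 : G)) (g := c) (f := Prod.fst) hcs contMDiffAt_fst)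
  · intro q
    rw [hc0, mul_one]
  · intro q
    have h1 : HasMFDerivAt 𝓘(ℝ, E) 𝓘(ℝ, E) (fun x ↦ q * x) (c 0)
        (mfderiv 𝓘(ℝ, E) 𝓘(ℝ, E) (fun x ↦ q * x) 1 : E →L[ℝ] E) := by
      rw [hc0]
      exact (hleft q 1).hasMFDerivAt
    have h2 := DFunLike.congr_fun (h1.comp (0 : ℝ) hcd).mfderiv (1 : ℝ)
    refine Eq.trans ?_ h2.symm
    exact congrArg (mfderiv 𝓘(ℝ, E) 𝓘(ℝ, E) (fun x ↦ q * x) 1) (one_smul ℝ (A : E)).symm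
  · intro t
    have hconj : MDifferentiableAt 𝓘(ℝ, E) 𝓘(ℝ, E) (fun y : G ↦ c t * y * (c t)⁻¹) 1 :=
      ((contMDiff_mul_right (I := 𝓘(ℝ, E)) (n := ∞) (a := (c t)⁻¹)).comp
        (contMDiff_mul_left (a := c t))).mdifferentiable (by simp) 1
    have h1 := mfderiv_comp_apply_of_eq (I := 𝓘(ℝ, E)) (I' := 𝓘(ℝ, E)) (I'' := 𝓘(ℝ, E))
      (x := (1 : G)) (y := (1 : G)) (g := fun y ↦ y * c t) (f := fun y ↦ c t * y * (c t)⁻¹)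
      (hright (c t) 1) hconj (by simp) B
    have h2 : (fun y ↦ y * c t) ∘ (fun y ↦ c t * y * (c t)⁻¹) = fun y ↦ c t * y := by
      funext y
      simp
    rw [h2] at h1
    refine h1.symm.trans ?_
    have h3 : ∀ x y : G, x = y → (mfderiv 𝓘(ℝ, E) 𝓘(ℝ, E) (fun z : G ↦ x * z) 1 B : E) =
        (mulInvariantVectorField B y : E) := by
      rintro x _ rfl; rfl
    exact h3 _ _ (one_mul _).symm

theorem hasVelocityAtOne_inv {A : GroupLieAlgebra 𝓘(ℝ, E) G} {c : ℝ → G}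
    (hc : HasVelocityAtOne c A) (hcs : ContMDiffAt 𝓘(ℝ, ℝ) 𝓘(ℝ, E) ∞ c 0) :
    HasVelocityAtOne (fun t ↦ (c t)⁻¹) (-A) := by
  obtain ⟨hc0, hcd⟩ := hc
  refine ⟨by simp [hc0], ?_⟩
  have hinv : HasMFDerivAt 𝓘(ℝ, ℝ) 𝓘(ℝ, E) (fun t ↦ (c t)⁻¹) 0
      (mfderiv 𝓘(ℝ, ℝ) 𝓘(ℝ, E) (fun t ↦ (c t)⁻¹) 0) :=
    (hcs.inv.mdifferentiableAt (by simp)).hasMFDerivAt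
  have hmul : MDifferentiableAt (𝓘(ℝ, E).prod 𝓘(ℝ, E)) 𝓘(ℝ, E)
      (fun p : G × G ↦ p.1 * p.2) (c 0, (c 0)⁻¹) :=
    (contMDiff_mul 𝓘(ℝ, E) ∞).mdifferentiable (by simp) _
  have h1 := (hmul.hasMFDerivAt.comp (0 : ℝ) (hcd.prodMk hinv)).mfderiv
  have h2 : (fun p : G × G ↦ p.1 * p.2) ∘ (fun t ↦ (c t, (c t)⁻¹)) = fun _ ↦ 1 := by
    funext t
    simp
  rw [h2, mfderiv_const] at h1
  refine hinv.congr_mfderiv (ContinuousLinearMap.ext fun r : ℝ ↦ ?_)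
  have h3 := (DFunLike.congr_fun h1 r).trans
    (mfderiv_mul_apply_of_eq_one (E := E) _ _ hc0 (by rw [hc0, inv_one]) (r • (A : E)) _)
  have h4 : ∀ u w : E, 0 = r • u + w → w = r • (-u) := by
    intro u w huw
    rw [smul_neg]
    exact eq_neg_of_add_eq_zero_right huw.symm
  exact h4 _ _ h3

theorem groupAd_groupAd_inv (x : G) (B : GroupLieAlgebra 𝓘(ℝ, E) G) :
    groupAd x (groupAd x⁻¹ B) = B := by
  have hconj : ∀ x : G, MDifferentiableAt 𝓘(ℝ, E) 𝓘(ℝ, E) (fun y : G ↦ x * y * x⁻¹) 1 := fun x ↦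
    ((contMDiff_mul_right (I := 𝓘(ℝ, E)) (n := ∞) (a := x⁻¹)).comp
      (contMDiff_mul_left (a := x))).mdifferentiable (by simp) 1
  have h1 := mfderiv_comp_apply_of_eq (I := 𝓘(ℝ, E)) (I' := 𝓘(ℝ, E)) (I'' := 𝓘(ℝ, E))
    (x := (1 : G)) (y := (1 : G)) (g := fun y ↦ x * y * x⁻¹) (f := fun y ↦ x⁻¹ * y * (x⁻¹)⁻¹)
    (hconj x) (hconj x⁻¹) (by simp) B
  have h2 : (fun y ↦ x * y * x⁻¹) ∘ (fun y ↦ x⁻¹ * y * (x⁻¹)⁻¹) = id := by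
    funext y
    simp [mul_assoc]
  rw [h2, mfderiv_id] at h1
  exact h1.symm

end Adjoint

namespace IsSmoothAction

variable [LieGroup 𝓘(ℝ, E) ∞ G] [CompleteSpace F] [IsManifold 𝓘(ℝ, F) ∞ M]
  {act : G → M → M}

/-- The map from the Lie algebra to the fundamental fields is an anti-homomorphism. -/
theorem mlieBracket_fundamentalField [CompleteSpace E] (h : IsSmoothAction E F act)
    (A B : GroupLieAlgebra 𝓘(ℝ, E) G) (o : M) :
    mlieBracket 𝓘(ℝ, F) (fundamentalField act A) (fundamentalField act B) o =
      -fundamentalField act ⁅A, B⁆ o := by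
  obtain ⟨c, hc, hcs⟩ := exists_contMDiffAt_hasVelocityAtOne A
  have h1 := h.hasDerivAt_mlieBracket_fundamentalField hc hcs
    (h.mdifferentiableAt_fundamentalField B o)
    (η := fun t ↦ infinitesimalAction act o (groupAd (c t)⁻¹ B)) (fun t ↦ by
      rw [h.mfderiv_infinitesimalAction, groupAd_groupAd_inv]
      rfl)
  have h2 := hasDerivAt_groupAd (hasVelocityAtOne_inv hc hcs) hcs.inv B
  let P : E →L[ℝ] F := infinitesimalAction act o
  have h3 := P.hasFDerivAt.comp_hasDerivAt (0 : ℝ) h2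
  refine (h1.unique h3).trans ?_
  rw [neg_lie]
  exact map_neg (infinitesimalAction act o) ⁅A, B⁆

/-- The Lie derivative of an invariant affinor along a fundamental field vanishes. -/
theorem mlieBracket_fundamentalField_affinorApply (h : IsSmoothAction E F act)
    {f : (q : M) → TangentSpace 𝓘(ℝ, F) q →L[ℝ] TangentSpace 𝓘(ℝ, F) q}
    (hf : ∀ (x : G) (q : M) (v : TangentSpace 𝓘(ℝ, F) q),
      mfderiv 𝓘(ℝ, F) 𝓘(ℝ, F) (act x) q (f q v) =
        f (act x q) (mfderiv 𝓘(ℝ, F) 𝓘(ℝ, F) (act x) q v))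
    (A : GroupLieAlgebra 𝓘(ℝ, E) G) {o : M} {Y : (q : M) → TangentSpace 𝓘(ℝ, F) q}
    (hY : MDifferentiableAt 𝓘(ℝ, F) 𝓘(ℝ, F).tangent
      (fun q ↦ (⟨q, Y q⟩ : TangentBundle 𝓘(ℝ, F) M)) o)
    (hfY : MDifferentiableAt 𝓘(ℝ, F) 𝓘(ℝ, F).tangent
      (fun q ↦ (⟨q, affinorApply f Y q⟩ : TangentBundle 𝓘(ℝ, F) M)) o) :
    mlieBracket 𝓘(ℝ, F) (fundamentalField act A) (affinorApply f Y) o =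
      f o (mlieBracket 𝓘(ℝ, F) (fundamentalField act A) Y o) := by
  obtain ⟨c, hc, hcs⟩ := exists_contMDiffAt_hasVelocityAtOne A
  obtain ⟨η, hη⟩ := h.exists_mfderiv_act_eq c o Y
  let f₀ : F →L[ℝ] F := f o
  have h1 := h.hasDerivAt_mlieBracket_fundamentalField hc hcs hY hη
  have h2 := h.hasDerivAt_mlieBracket_fundamentalField hc hcs hfY (η := fun t ↦ f₀ (η t))
    (fun t ↦ (hf (c t) o (η t)).trans (congrArg (f (act (c t) o)) (hη t)))
  exact h2.unique (f₀.hasFDerivAt.comp_hasDerivAt (0 : ℝ) h1)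

end IsSmoothAction

end SmoothAction

/-! ### Invariant metrics and affinors -/

section InvariantStructures

open Filter VectorField
open scoped Topology

variable {E : Type*} [NormedAddCommGroup E] [NormedSpace ℝ E]
  {G : Type*} [TopologicalSpace G] [ChartedSpace E G] [Group G] [LieGroup 𝓘(ℝ, E) ∞ G]
  {F : Type*} [NormedAddCommGroup F] [NormedSpace ℝ F]
  {M : Type*} [TopologicalSpace M] [ChartedSpace F M] [IsManifold 𝓘(ℝ, F) ∞ M]
  {act : G → M → M}
  {g : Bundle.ContMDiffRiemannianMetric 𝓘(ℝ, F) ∞ F (fun p : M ↦ TangentSpace 𝓘(ℝ, F) p)}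
  {nabla : CovariantDerivative 𝓘(ℝ, F) F (fun p : M ↦ TangentSpace 𝓘(ℝ, F) p)}
  {f : (p : M) → TangentSpace 𝓘(ℝ, F) p →L[ℝ] TangentSpace 𝓘(ℝ, F) p}

theorem mdifferentiableAt_metric_apply {o : M} {Y Z : (q : M) → TangentSpace 𝓘(ℝ, F) q}
    (hY : MDifferentiableAt 𝓘(ℝ, F) 𝓘(ℝ, F).tangent
      (fun q ↦ (⟨q, Y q⟩ : TangentBundle 𝓘(ℝ, F) M)) o)
    (hZ : MDifferentiableAt 𝓘(ℝ, F) 𝓘(ℝ, F).tangent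
      (fun q ↦ (⟨q, Z q⟩ : TangentBundle 𝓘(ℝ, F) M)) o) :
    MDifferentiableAt 𝓘(ℝ, F) 𝓘(ℝ, ℝ) (fun q ↦ g.inner q (Y q) (Z q)) o := by
  have h1 : MDifferentiableAt 𝓘(ℝ, F) (𝓘(ℝ, F).prod 𝓘(ℝ, ℝ))
      (fun q ↦ Bundle.TotalSpace.mk' ℝ (E := Bundle.Trivial M ℝ) q (g.inner q (Y q) (Z q))) o :=
    MDifferentiableAt.clm_bundle_apply₂ (F₁ := F) (F₂ := F) (F₃ := ℝ)
      (g.contMDiff.mdifferentiable (by simp) o) hY hZ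
  simp only [mdifferentiableAt_totalSpace] at h1
  exact h1.2

theorem IsMetricFStructure.mdifferentiableAt_affinorApply (hf : IsMetricFStructure g f) {o : M}
    {Y : (q : M) → TangentSpace 𝓘(ℝ, F) q}
    (hY : MDifferentiableAt 𝓘(ℝ, F) 𝓘(ℝ, F).tangent
      (fun q ↦ (⟨q, Y q⟩ : TangentBundle 𝓘(ℝ, F) M)) o) :
    MDifferentiableAt 𝓘(ℝ, F) 𝓘(ℝ, F).tangent
      (fun q ↦ (⟨q, affinorApply f Y q⟩ : TangentBundle 𝓘(ℝ, F) M)) o :=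
  MDifferentiableAt.clm_bundle_apply (F₁ := F) (F₂ := F)
    (hf.smooth.mdifferentiable (by simp) o) hY

namespace IsSmoothAction

variable [CompleteSpace F]

/-- Fundamental fields are Killing fields of an invariant metric. -/
theorem mvfderiv_metric_fundamentalField (h : IsSmoothAction E F act)
    (hg : ∀ (x : G) (q : M) (v w : TangentSpace 𝓘(ℝ, F) q),
      g.inner (act x q) (mfderiv 𝓘(ℝ, F) 𝓘(ℝ, F) (act x) q v)
        (mfderiv 𝓘(ℝ, F) 𝓘(ℝ, F) (act x) q w) = g.inner q v w)
    (A : GroupLieAlgebra 𝓘(ℝ, E) G) {o : M} {Y Z : (q : M) → TangentSpace 𝓘(ℝ, F) q}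
    (hY : MDifferentiableAt 𝓘(ℝ, F) 𝓘(ℝ, F).tangent
      (fun q ↦ (⟨q, Y q⟩ : TangentBundle 𝓘(ℝ, F) M)) o)
    (hZ : MDifferentiableAt 𝓘(ℝ, F) 𝓘(ℝ, F).tangent
      (fun q ↦ (⟨q, Z q⟩ : TangentBundle 𝓘(ℝ, F) M)) o) :
    mvfderiv 𝓘(ℝ, F) (fun q : M ↦ g.inner q (Y q) (Z q)) o (fundamentalField act A o) =
      g.inner o (mlieBracket 𝓘(ℝ, F) (fundamentalField act A) Y o) (Z o) +
        g.inner o (Y o) (mlieBracket 𝓘(ℝ, F) (fundamentalField act A) Z o) := by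
  obtain ⟨c, hc, hcs⟩ := exists_contMDiffAt_hasVelocityAtOne A
  obtain ⟨η, hη⟩ := h.exists_mfderiv_act_eq c o Y
  obtain ⟨ζ, hζ⟩ := h.exists_mfderiv_act_eq c o Z
  have h1 := h.hasDerivAt_mlieBracket_fundamentalField hc hcs hY hη
  have h2 := h.hasDerivAt_mlieBracket_fundamentalField hc hcs hZ hζ
  obtain ⟨hc0, hcd⟩ := hc
  let g₀ : F →L[ℝ] F →L[ℝ] ℝ := g.inner o
  have h3 : HasDerivAt (fun t ↦ g₀ (η t) (ζ t)) _ 0 :=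
    (g₀.hasFDerivAt.comp_hasDerivAt (0 : ℝ) h1).clm_apply h2
  have h4 : ∀ t, g₀ (η t) (ζ t) =
      g.inner (act (c t) o) (Y (act (c t) o)) (Z (act (c t) o)) := by
    intro t
    have h5 := hg (c t) o (η t) (ζ t)
    have h6 : ∀ v w v' w' : TangentSpace 𝓘(ℝ, F) (act (c t) o), v = v' → w = w' →
      g.inner (act (c t) o) v w = g.inner (act (c t) o) v' w' := by
        rintro v w _ _ rfl rfl; rfl
    exact h5.symm.trans (h6 _ _ _ _ (hη t) (hζ t))
  have hact0 : act (c 0) = id := by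
    funext q
    rw [hc0, h.one, id]
  have h0 : ∀ (φ : M → M) (v : F) (X : (q : M) → TangentSpace 𝓘(ℝ, F) q), φ = id →
      (mfderiv 𝓘(ℝ, F) 𝓘(ℝ, F) φ o v : F) = X (φ o) → v = X o := by
    rintro _ v X rfl hv
    rw [mfderiv_id] at hv
    exact hv
  have hη0 : η 0 = Y o := h0 _ _ _ hact0 (hη 0)
  have hζ0 : ζ 0 = Z o := h0 _ _ _ hact0 (hζ 0)
  have ho : act (c 0) o = o := congrFun hact0 o
  have h5 : HasMFDerivAt 𝓘(ℝ, E) 𝓘(ℝ, F) (fun x ↦ act x o) (c 0)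
      (infinitesimalAction act o : E →L[ℝ] F) := by
    rw [hc0]
    exact (h.mdifferentiableAt_orbit 1 o).hasMFDerivAt
  have h6 : HasMFDerivAt 𝓘(ℝ, F) 𝓘(ℝ, ℝ) (fun q ↦ g.inner q (Y q) (Z q)) (act (c 0) o)
      (mvfderiv 𝓘(ℝ, F) (fun q ↦ g.inner q (Y q) (Z q)) o : F →L[ℝ] ℝ) := by
    rw [ho]
    exact (mdifferentiableAt_metric_apply hY hZ).hasMFDerivAt
  let d : F →L[ℝ] ℝ := mvfderiv 𝓘(ℝ, F) (fun q ↦ g.inner q (Y q) (Z q)) o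
  let P : E →L[ℝ] F := infinitesimalAction act o
  have h7 : HasFDerivAt (fun t ↦ g.inner (act (c t) o) (Y (act (c t) o)) (Z (act (c t) o)))
      (d ∘L P ∘L ContinuousLinearMap.toSpanSingleton (M₁ := E) ℝ A) 0 :=
    (HasMFDerivAt.comp (0 : ℝ) (f := fun t ↦ act (c t) o) h6 (h5.comp (0 : ℝ) hcd)).hasFDerivAt
  have h8 := (h7.hasDerivAt.congr_of_eventuallyEq (Eventually.of_forall h4)).unique h3
  have h9 : (d ∘L P ∘L ContinuousLinearMap.toSpanSingleton (M₁ := E) ℝ A) (1 : ℝ) =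
      d (fundamentalField act A o) :=
    congrArg (fun v ↦ d (P v)) (one_smul ℝ (A : E))
  rw [h9, Function.comp_apply, hη0, hζ0] at h8
  exact h8

/-- The covariant derivative of an invariant affinor: as `nabla` is torsion-free and `f` is
invariant, `∇_X (f) Y = ∇_{f Y} A^* - f (∇_Y A^*)` at a point where `X` agrees with the
fundamental field `A^*`. -/
theorem nablaAffinor_eq (h : IsSmoothAction E F act) (hnabla : IsLeviCivita g nabla)
    (hfm : IsMetricFStructure g f)
    (hf : ∀ (x : G) (q : M) (v : TangentSpace 𝓘(ℝ, F) q),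
      mfderiv 𝓘(ℝ, F) 𝓘(ℝ, F) (act x) q (f q v) =
        f (act x q) (mfderiv 𝓘(ℝ, F) 𝓘(ℝ, F) (act x) q v))
    {A : GroupLieAlgebra 𝓘(ℝ, E) G} {o : M} {X Y : (q : M) → TangentSpace 𝓘(ℝ, F) q}
    (hX : X o = infinitesimalAction act o A)
    (hY : MDifferentiableAt 𝓘(ℝ, F) 𝓘(ℝ, F).tangent
      (fun q ↦ (⟨q, Y q⟩ : TangentBundle 𝓘(ℝ, F) M)) o) :
    nablaAffinor nabla f X Y o =
      nabla (fundamentalField act A) o (f o (Y o)) -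
        f o (nabla (fundamentalField act A) o (Y o)) := by
  have hV := h.mdifferentiableAt_fundamentalField A o
  have hfY := hfm.mdifferentiableAt_affinorApply hY
  have h1 := hnabla.torsion_free _ _ o hV hfY
  rw [h.mlieBracket_fundamentalField_affinorApply hf A hY hfY,
    ← hnabla.torsion_free _ _ o hV hY, map_sub] at h1
  have h2 : fundamentalField act A o = X o := hX.symm
  rw [h2] at h1
  have h3 : affinorApply f Y o = f o (Y o) := rfl
  rw [h3] at h1
  exact sub_eq_sub_iff_sub_eq_sub.2 h1

/-- Koszul's formula for fundamental fields. -/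
theorem two_mul_metric_nabla_fundamentalField [CompleteSpace E] (h : IsSmoothAction E F act)
    (hnabla : IsLeviCivita g nabla)
    (hg : ∀ (x : G) (q : M) (v w : TangentSpace 𝓘(ℝ, F) q),
      g.inner (act x q) (mfderiv 𝓘(ℝ, F) 𝓘(ℝ, F) (act x) q v)
        (mfderiv 𝓘(ℝ, F) 𝓘(ℝ, F) (act x) q w) = g.inner q v w)
    (o : M) (A B C : GroupLieAlgebra 𝓘(ℝ, E) G) :
    2 * g.inner o (nabla (fundamentalField act A) o (infinitesimalAction act o B))
        (infinitesimalAction act o C) =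
      -(g.inner o (infinitesimalAction act o ⁅B, A⁆) (infinitesimalAction act o C) +
        g.inner o (infinitesimalAction act o ⁅B, C⁆) (infinitesimalAction act o A) +
        g.inner o (infinitesimalAction act o ⁅A, C⁆) (infinitesimalAction act o B)) := by
  set P : GroupLieAlgebra 𝓘(ℝ, E) G →L[ℝ] TangentSpace 𝓘(ℝ, F) o := infinitesimalAction act o
  set n : GroupLieAlgebra 𝓘(ℝ, E) G → GroupLieAlgebra 𝓘(ℝ, E) G →
    GroupLieAlgebra 𝓘(ℝ, E) G → ℝ := fun A B C ↦
      g.inner o (nabla (fundamentalField act A) o (P B)) (P C) with hn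
  have hV := fun A : GroupLieAlgebra 𝓘(ℝ, E) G ↦ h.mdifferentiableAt_fundamentalField A o
  have hPV : ∀ A, fundamentalField act A o = P A := fun _ ↦ rfl
  have hbr := fun A B : GroupLieAlgebra 𝓘(ℝ, E) G ↦ h.mlieBracket_fundamentalField A B o
  have hneg : ∀ A B C, g.inner o (P ⁅A, B⁆) (P C) = - g.inner o (P ⁅B, A⁆) (P C) := by
    intro A B C
    rw [← lie_skew, map_neg, map_neg, neg_apply]
  have hmet : ∀ A B C, n A B C + n C B A =
      -(g.inner o (P ⁅B, A⁆) (P C) + g.inner o (P ⁅B, C⁆) (P A)) := by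
    intro A B C
    have h1 := hnabla.metric (fundamentalField act B) _ _ o (hV A) (hV C)
    rw [h.mvfderiv_metric_fundamentalField hg B (hV A) (hV C), hbr, hbr] at h1
    simp only [hPV, map_neg, neg_apply] at h1
    rw [g.symm o (P A) (P ⁅B, C⁆), g.symm o (P A)] at h1
    simp only [hn]
    linarith
  have htor : ∀ A B C, n A B C - n B A C = - g.inner o (P ⁅B, A⁆) (P C) := by
    intro A B C
    have h1 := congrArg (fun v ↦ g.inner o v (P C)) (hnabla.torsion_free _ _ o (hV B) (hV A))
    rw [hbr] at h1
    simp only [hPV, map_neg, neg_apply, map_sub, sub_apply] at h1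
    exact h1
  change 2 * n A B C = _
  linarith [hmet A B C, hmet B C A, hmet C A B, htor A B C, htor B C A, htor C A B,
    hneg A B C, hneg B C A, hneg C A B]

end IsSmoothAction

end InvariantStructures

/-! ### The projection from a Lie group to a homogeneous space -/

section Submersion

open Filter
open scoped Topology

variable {E : Type*} [NormedAddCommGroup E] [NormedSpace ℝ E]
  {N : Type*} [TopologicalSpace N] [ChartedSpace E N]
  {F : Type*} [NormedAddCommGroup F] [NormedSpace ℝ F]
  {M : Type*} [TopologicalSpace M] [ChartedSpace F M]

theorem Manifold.IsSubmersionAt.exists_local_section {π : N → M} {x : N}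
    (h : Manifold.IsSubmersionAt 𝓘(ℝ, E) 𝓘(ℝ, F) ∞ π x) :
    ∃ s : M → N, s (π x) = x ∧ ContMDiffAt 𝓘(ℝ, F) 𝓘(ℝ, E) ∞ s (π x) ∧
      ∀ᶠ q in 𝓝 (π x), π (s q) = q := by
  set φ := h.domChart
  set ψ := h.codChart
  have hx : x ∈ φ.source := h.mem_domChart_source
  have hπx : π x ∈ ψ.source := h.mem_codChart_source
  have hφ : φ ∈ IsManifold.maximalAtlas 𝓘(ℝ, E) ∞ N := h.domChart_mem_maximalAtlas
  have hψ : ψ ∈ IsManifold.maximalAtlas 𝓘(ℝ, F) ∞ M := h.codChart_mem_maximalAtlas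
  have hw : ∀ e ∈ φ.target, ψ (π (φ.symm e)) = (h.equiv e).1 := by
    intro e he
    have he' : e ∈ (h.domChart.extend 𝓘(ℝ, E)).target := by simpa using he
    simpa using h.writtenInCharts he'
  let l : M → E := fun q ↦ h.equiv.symm (ψ q, (h.equiv (φ x)).2)
  have hlx : l (π x) = φ x := by
    have h1 := hw (φ x) (φ.map_source hx)
    rw [φ.left_inv hx] at h1
    simp [l, h1]
  have hl : ContMDiffAt 𝓘(ℝ, F) 𝓘(ℝ, E) ∞ l (π x) := by
    have h1 : ContMDiffAt 𝓘(ℝ, F) 𝓘(ℝ, F) ∞ ψ (π x) :=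
      contMDiffAt_of_mem_maximalAtlas hψ hπx
    have h2 : ContDiff ℝ ∞ (fun u : F ↦ h.equiv.symm (u, (h.equiv (φ x)).2)) := by fun_prop
    exact h2.contMDiff.contMDiffAt.comp (π x) h1
  refine ⟨fun q ↦ φ.symm (l q), (congrArg φ.symm hlx).trans (φ.left_inv hx), ?_, ?_⟩
  · refine ContMDiffAt.comp_of_eq (g := φ.symm) (y := φ x) ?_ hl hlx
    exact contMDiffAt_symm_of_mem_maximalAtlas hφ (φ.map_source hx)
  · have h1 : ∀ᶠ q in 𝓝 (π x), l q ∈ φ.target := by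
      refine hl.continuousAt.eventually_mem ?_
      rw [hlx]
      exact φ.open_target.mem_nhds (φ.map_source hx)
    filter_upwards [h1, ψ.open_source.mem_nhds hπx] with q hq hqs
    refine ψ.injOn ?_ hqs ?_
    · exact h.source_subset_preimage_source (φ.map_target hq)
    · rw [hw _ hq]
      simp [l]

end Submersion

section Quotient

open Filter
open scoped Topology

variable {E : Type*} [NormedAddCommGroup E] [NormedSpace ℝ E]
  {G : Type*} [TopologicalSpace G] [ChartedSpace E G] [Group G]
  {H : Subgroup G}
  {F : Type*} [NormedAddCommGroup F] [NormedSpace ℝ F] [ChartedSpace F (G ⧸ H)]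

theorem IsSmoothAction.infinitesimalAction_conj {M : Type*} [TopologicalSpace M]
    [ChartedSpace F M] {act : G → M → M} (h : IsSmoothAction E F act) (a : G) (o : M)
    (A : GroupLieAlgebra 𝓘(ℝ, E) G) :
    (infinitesimalAction (fun x q ↦ act (a * x * a⁻¹) q) (act a o) A : F) =
      mfderiv 𝓘(ℝ, F) 𝓘(ℝ, F) (act a) o (infinitesimalAction act o A) := by
  have h1 := mfderiv_comp_apply_of_eq (I := 𝓘(ℝ, E)) (I' := 𝓘(ℝ, F)) (I'' := 𝓘(ℝ, F))
    (x := (1 : G)) (y := o) (g := act a) (f := fun y ↦ act y o)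
    (h.mdifferentiableAt_left a o) (h.mdifferentiableAt_orbit 1 o) (h.one o) A
  have h2 : act a ∘ (fun y ↦ act y o) = fun x ↦ act (a * x * a⁻¹) (act a o) := by
    funext x
    simp only [Function.comp_apply, ← h.mul]
    congr 1
    group
  rw [h2] at h1
  exact h1

theorem infinitesimalAction_smul_one (A : GroupLieAlgebra 𝓘(ℝ, E) G) :
    infinitesimalAction (F := F) (fun (x : G) (q : G ⧸ H) ↦ x • q) ((1 : G) : G ⧸ H) A =
      dProjection H A := by
  have h1 : (fun x : G ↦ x • ((1 : G) : G ⧸ H)) = fun x : G ↦ (x : G ⧸ H) := by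
    funext x
    exact congrArg _ (mul_one x)
  have h2 : ∀ k : G → G ⧸ H, k = (fun x : G ↦ (x : G ⧸ H)) →
      (mfderiv 𝓘(ℝ, E) 𝓘(ℝ, F) k 1 A : F) = (dProjection H A : F) := by
    rintro _ rfl; rfl
  exact h2 _ h1

theorem dProjection_surjective
    (hπ : Manifold.IsSubmersion 𝓘(ℝ, E) 𝓘(ℝ, F) ∞ (fun x : G ↦ (x : G ⧸ H))) :
    Function.Surjective (dProjection (E := E) (F := F) H) := by
  intro v
  obtain ⟨s, hs1, hs, hsec⟩ := (hπ.isSubmersionAt 1).exists_local_section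
  refine ⟨(mfderiv 𝓘(ℝ, F) 𝓘(ℝ, E) s ((1 : G) : G ⧸ H) v : E), ?_⟩
  have h1 := mfderiv_comp_apply_of_eq (I := 𝓘(ℝ, F)) (I' := 𝓘(ℝ, E)) (I'' := 𝓘(ℝ, F))
    (x := ((1 : G) : G ⧸ H)) (y := (1 : G)) (g := fun x : G ↦ (x : G ⧸ H)) (f := s)
    (hπ.contMDiff.mdifferentiable (by simp) 1) (hs.mdifferentiableAt (by simp)) hs1 v
  have h2 : (fun x : G ↦ (x : G ⧸ H)) ∘ s =ᶠ[𝓝 ((1 : G) : G ⧸ H)] id := hsec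
  rw [h2.mfderiv_eq, mfderiv_id] at h1
  exact h1.symm

variable [LieGroup 𝓘(ℝ, E) ∞ G]

/-- The action of `G` on `G/H` is smooth: composed with a local section of the projection it is
the multiplication of `G`. -/
theorem isSmoothAction_smul_quotient
    (hπ : Manifold.IsSubmersion 𝓘(ℝ, E) 𝓘(ℝ, F) ∞ (fun x : G ↦ (x : G ⧸ H))) :
    IsSmoothAction E F (fun (x : G) (q : G ⧸ H) ↦ x • q) where
  one := one_smul G
  mul := mul_smul
  smooth := by
    rintro ⟨a, q⟩
    obtain ⟨x, rfl⟩ := QuotientGroup.mk_surjective q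
    obtain ⟨s, hsx, hs, hsec⟩ := (hπ.isSubmersionAt x).exists_local_section
    have h1 : ContMDiffAt (𝓘(ℝ, E).prod 𝓘(ℝ, F)) 𝓘(ℝ, F) ∞
        (fun p : G × (G ⧸ H) ↦ ((p.1 * s p.2 : G) : G ⧸ H)) (a, (x : G ⧸ H)) := by
      refine (hπ.contMDiff _).comp (a, (x : G ⧸ H)) (contMDiffAt_fst.mul ?_)
      exact ContMDiffAt.comp (a, (x : G ⧸ H)) (g := s) (f := Prod.snd) hs contMDiffAt_snd
    refine h1.congr_of_eventuallyEq ?_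
    have h2 : Tendsto (Prod.snd : G × (G ⧸ H) → G ⧸ H) (𝓝 (a, (x : G ⧸ H))) (𝓝 (x : G ⧸ H)) :=
      continuous_snd.tendsto _
    filter_upwards [h2.eventually hsec] with p hp
    nth_rewrite 1 [← hp]
    rfl

/-- The action by the conjugates `a * x * a⁻¹`. Its orbit map at `a • o` is the orbit map of
the original action at `o` followed by the translation by `a`, which moves questions from any
point to the base point. -/
theorem IsSmoothAction.conj {M : Type*} [TopologicalSpace M] [ChartedSpace F M]
    {act : G → M → M} (h : IsSmoothAction E F act) (a : G) :
    IsSmoothAction E F (fun x q ↦ act (a * x * a⁻¹) q) where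
  one q := by simp [h.one]
  mul x y q := by
    rw [← h.mul]
    congr 1
    group
  smooth := by
    refine h.smooth.comp (ContMDiff.prodMk ?_ contMDiff_snd)
    exact (contMDiff_const.mul contMDiff_fst).mul contMDiff_const

/-- The isotropy representation of `H` on the tangent space at the base point is induced by the
adjoint action. -/
theorem dTranslation_dProjection
    (hπ : Manifold.IsSubmersion 𝓘(ℝ, E) 𝓘(ℝ, F) ∞ (fun x : G ↦ (x : G ⧸ H)))
    {h : G} (hh : h ∈ H) (A : GroupLieAlgebra 𝓘(ℝ, E) G) :
    (dTranslation (F := F) h ((1 : G) : G ⧸ H) (dProjection H A) : F) =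
      dProjection (F := F) H (groupAd h A) := by
  have h1 := (isSmoothAction_smul_quotient hπ).mfderiv_infinitesimalAction h
    ((1 : G) : G ⧸ H) A
  have h2 : h • ((1 : G) : G ⧸ H) = ((1 : G) : G ⧸ H) := by
    refine QuotientGroup.eq.2 ?_
    simpa using hh
  rw [infinitesimalAction_smul_one] at h1
  refine h1.trans ?_
  have h3 : ∀ q : G ⧸ H, q = ((1 : G) : G ⧸ H) →
      (infinitesimalAction (F := F) (fun (x : G) (q : G ⧸ H) ↦ x • q) q (groupAd h A) : F) =
        dProjection (F := F) H (groupAd h A) := by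
    rintro _ rfl
    exact infinitesimalAction_smul_one _
  exact h3 _ h2

theorem dProjection_eq_zero_of_mem
    (hπ : Manifold.IsSubmersion 𝓘(ℝ, E) 𝓘(ℝ, F) ∞ (fun x : G ↦ (x : G ⧸ H)))
    {A : GroupLieAlgebra 𝓘(ℝ, E) G} (hA : A ∈ subgroupLieAlgebra H) :
    dProjection (F := F) H A = 0 := by
  obtain ⟨γ, hγH, hγ0, hγ⟩ := hA
  have hd : HasMFDerivAt 𝓘(ℝ, E) 𝓘(ℝ, F) (fun x : G ↦ (x : G ⧸ H)) (γ 0)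
      (dProjection (F := F) H : E →L[ℝ] F) := by
    rw [hγ0]
    exact (hπ.contMDiff.mdifferentiable (by simp) 1).hasMFDerivAt
  have h1 := (hd.comp (0 : ℝ) hγ).mfderiv
  have h2 : (fun x : G ↦ (x : G ⧸ H)) ∘ γ = fun _ ↦ ((1 : G) : G ⧸ H) := by
    funext t
    refine QuotientGroup.eq.2 ?_
    simpa using hγH t
  rw [h2, mfderiv_const] at h1
  have h3 := DFunLike.congr_fun h1 (1 : ℝ)
  exact (h3.trans (congrArg (dProjection (F := F) H) (one_smul ℝ (A : E)))).symm

/-- The kernel of the projection `𝔤 → T_o (G/H)` is contained in the Lie algebra of `H`: for a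
local section `s` of `G → G/H` and a curve `c` in `G`, the curve `(s (c H))⁻¹ * c` lies in `H`,
and it has the same velocity at `1` if that of `c` is in the kernel. -/
theorem mem_subgroupLieAlgebra_of_dProjection_eq_zero
    (hπ : Manifold.IsSubmersion 𝓘(ℝ, E) 𝓘(ℝ, F) ∞ (fun x : G ↦ (x : G ⧸ H)))
    {A : GroupLieAlgebra 𝓘(ℝ, E) G} (hA : dProjection (F := F) H A = 0) :
    A ∈ subgroupLieAlgebra H := by
  classical
  obtain ⟨s, hs1, hs, hsec⟩ := (hπ.isSubmersionAt 1).exists_local_section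
  obtain ⟨c, ⟨hc0, hcd⟩, hcs⟩ := exists_contMDiffAt_hasVelocityAtOne A
  let π : G → G ⧸ H := fun x ↦ (x : G ⧸ H)
  have hd : HasMFDerivAt 𝓘(ℝ, E) 𝓘(ℝ, F) π (c 0) (dProjection (F := F) H : E →L[ℝ] F) := by
    rw [hc0]
    exact (hπ.contMDiff.mdifferentiable (by simp) 1).hasMFDerivAt
  have hπc : ContMDiffAt 𝓘(ℝ, ℝ) 𝓘(ℝ, F) ∞ (π ∘ c) 0 :=
    ContMDiffAt.comp (0 : ℝ) (hπ.contMDiff _) hcs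
  have hπc0 : (π ∘ c) 0 = π 1 := congrArg π hc0
  have hr : ContMDiffAt 𝓘(ℝ, ℝ) 𝓘(ℝ, E) ∞ (s ∘ π ∘ c) 0 :=
    ContMDiffAt.comp_of_eq (y := π 1) hs hπc hπc0
  have hrv : HasVelocityAtOne (s ∘ π ∘ c) (0 : GroupLieAlgebra 𝓘(ℝ, E) G) := by
    refine ⟨(congrArg s hπc0).trans hs1, ?_⟩
    have h1 : HasMFDerivAt 𝓘(ℝ, F) 𝓘(ℝ, E) s ((π ∘ c) 0)
        (mfderiv 𝓘(ℝ, F) 𝓘(ℝ, E) s (π 1) : F →L[ℝ] E) := by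
      rw [hπc0]
      exact (hs.mdifferentiableAt (by simp)).hasMFDerivAt
    refine (h1.comp (0 : ℝ) (hd.comp (0 : ℝ) hcd)).congr_mfderiv ?_
    refine ContinuousLinearMap.ext fun r : ℝ ↦ ?_
    have h2 : dProjection (F := F) H (r • A) = 0 := by rw [map_smul, hA, smul_zero]
    exact (congrArg (mfderiv 𝓘(ℝ, F) 𝓘(ℝ, E) s (π 1)) h2).trans
      ((map_zero _).trans (smul_zero (A := E) r).symm)
  obtain ⟨hi0, hid⟩ := hasVelocityAtOne_inv hrv hr
  let γ₀ : ℝ → G := fun t ↦ ((s ∘ π ∘ c) t)⁻¹ * c t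
  have hγ₀ : HasMFDerivAt 𝓘(ℝ, ℝ) 𝓘(ℝ, E) γ₀ 0
      (ContinuousLinearMap.toSpanSingleton (M₁ := E) ℝ A) := by
    have hmul : MDifferentiableAt (𝓘(ℝ, E).prod 𝓘(ℝ, E)) 𝓘(ℝ, E)
        (fun p : G × G ↦ p.1 * p.2) (((s ∘ π ∘ c) 0)⁻¹, c 0) :=
      (contMDiff_mul 𝓘(ℝ, E) ∞).mdifferentiable (by simp) _
    refine (hmul.hasMFDerivAt.comp (0 : ℝ) (hid.prodMk hcd)).congr_mfderiv ?_
    refine ContinuousLinearMap.ext fun r : ℝ ↦ ?_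
    refine (mfderiv_mul_apply_of_eq_one (E := E) _ _ hi0 hc0 (r • (-(0 : E))) (r • A)).trans ?_
    have h1 : ∀ u : E, r • (-(0 : E)) + r • u = r • u := fun u ↦ by simp
    exact h1 A
  refine ⟨fun t ↦ if γ₀ t ∈ H then γ₀ t else 1, fun t ↦ ?_, ?_, ?_⟩
  · dsimp only
    split_ifs with ht
    · exact ht
    · exact H.one_mem
  · have h1 : γ₀ 0 = 1 := by
      simp only [γ₀, hc0, mul_one]
      exact hi0
    simp [h1]
  · refine hγ₀.congr_of_eventuallyEq ?_
    have h1 : Tendsto (π ∘ c) (𝓝 0) (𝓝 (π 1)) := by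
      rw [← hπc0]
      exact hπc.continuousAt
    filter_upwards [h1.eventually hsec] with t ht
    have h2 : γ₀ t ∈ H := QuotientGroup.eq.1 ht
    simp [h2]

end Quotient

/-! ### Orthogonality of inequivalent summands -/

section Schur

variable {E : Type*} [NormedAddCommGroup E] [NormedSpace ℝ E]
  {G : Type*} [TopologicalSpace G] [ChartedSpace E G] [Group G] [LieGroup 𝓘(ℝ, E) ∞ G]
  {H : Subgroup G}

theorem isAdInvariant_inf_orthogonal
    (β : LinearMap.BilinForm ℝ (GroupLieAlgebra 𝓘(ℝ, E) G))
    (hinv : ∀ h ∈ H, ∀ x y, β (groupAd h x) (groupAd h y) = β x y)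
    {V W : Submodule ℝ (GroupLieAlgebra 𝓘(ℝ, E) G)}
    (hV : IsAdInvariant H V) (hW : IsAdInvariant H W) :
    IsAdInvariant H (V ⊓ LinearMap.BilinForm.orthogonal β.flip W) := by
  rintro h hh x ⟨hxV, hxW⟩
  refine ⟨hV h hh x hxV, fun y hy ↦ ?_⟩
  have h1 : β x (groupAd h⁻¹ y) = 0 := hxW _ (hW _ (H.inv_mem hh) y hy)
  change β (groupAd h x) y = 0
  rw [← groupAd_groupAd_inv h y, hinv h hh, h1]

variable [FiniteDimensional ℝ E]

instance finiteDimensional_groupLieAlgebra :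
    FiniteDimensional ℝ (GroupLieAlgebra 𝓘(ℝ, E) G) :=
  inferInstanceAs (FiniteDimensional ℝ E)

/-- Inequivalent irreducible `Ad(H)`-modules are orthogonal for any symmetric invariant form that
is definite on one of them. -/
theorem bilinForm_eq_zero_of_not_areAdEquivalent
    (β : LinearMap.BilinForm ℝ (GroupLieAlgebra 𝓘(ℝ, E) G)) (hsymm : ∀ x y, β x y = β y x)
    (hinv : ∀ h ∈ H, ∀ x y, β (groupAd h x) (groupAd h y) = β x y)
    {V W : Submodule ℝ (GroupLieAlgebra 𝓘(ℝ, E) G)}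
    (hV : IsAdIrreducible H V) (hW : IsAdIrreducible H W) (hVW : ¬ AreAdEquivalent H V W)
    (hpos : ∀ x ∈ W, β x x = 0 → x = 0) {x y : GroupLieAlgebra 𝓘(ℝ, E) G}
    (hx : x ∈ V) (hy : y ∈ W) : β x y = 0 := by
  by_contra hxy
  have hVW' : ∀ x ∈ V, (∀ y ∈ W, β x y = 0) → x = 0 := by
    rcases hV.2.2 _ inf_le_left (isAdInvariant_inf_orthogonal β hinv hV.1 hW.1) with h | h
    · intro u hu huW
      have h1 : u ∈ V ⊓ LinearMap.BilinForm.orthogonal β.flip W := ⟨hu, huW⟩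
      rwa [h, Submodule.mem_bot] at h1
    · exact absurd ((h.ge hx).2 y hy) hxy
  have hWV' : ∀ y ∈ W, (∀ x ∈ V, β x y = 0) → y = 0 := by
    rcases hW.2.2 _ inf_le_left (isAdInvariant_inf_orthogonal β hinv hW.1 hV.1) with h | h
    · intro u hu huV
      have h1 : u ∈ W ⊓ LinearMap.BilinForm.orthogonal β.flip V :=
        ⟨hu, fun v hv ↦ (hsymm _ _).trans (huV v hv)⟩
      rwa [h, Submodule.mem_bot] at h1
    · exact absurd ((hsymm _ _).trans ((h.ge hy).2 x hx)) hxy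
  have hWW' : ∀ y ∈ W, (∀ z ∈ W, β y z = 0) → y = 0 := fun y hy h ↦ hpos y hy (h y hy)
  -- the form embeds `V` and `W` into the dual spaces of `W` and `V`, so the dimensions agree, and
  -- `V ≃ W* ≃ W` is an equivalence of modules
  let a : V →ₗ[ℝ] Module.Dual ℝ W := (β.domRestrict V).compl₂ W.subtype
  let b : W →ₗ[ℝ] Module.Dual ℝ V := (β.flip.domRestrict W).compl₂ V.subtype
  let d : W →ₗ[ℝ] Module.Dual ℝ W := (β.domRestrict W).compl₂ W.subtype
  have ha : Function.Injective a := by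
    refine (injective_iff_map_eq_zero a).2 fun u hu ↦ Subtype.ext (hVW' u u.2 fun w hw ↦ ?_)
    exact LinearMap.congr_fun hu ⟨w, hw⟩
  have hb : Function.Injective b := by
    refine (injective_iff_map_eq_zero b).2 fun u hu ↦ Subtype.ext (hWV' u u.2 fun w hw ↦ ?_)
    exact LinearMap.congr_fun hu ⟨w, hw⟩
  have hd : Function.Injective d := by
    refine (injective_iff_map_eq_zero d).2 fun u hu ↦ Subtype.ext (hWW' u u.2 fun w hw ↦ ?_)
    exact LinearMap.congr_fun hu ⟨w, hw⟩
  have hdim : Module.finrank ℝ V = Module.finrank ℝ (Module.Dual ℝ W) := by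
    refine le_antisymm (LinearMap.finrank_le_finrank_of_injective ha) ?_
    rw [Subspace.dual_finrank_eq, ← Subspace.dual_finrank_eq (V := V)]
    exact LinearMap.finrank_le_finrank_of_injective hb
  let ae := LinearMap.linearEquivOfInjective a ha hdim
  let de := LinearMap.linearEquivOfInjective d hd Subspace.dual_finrank_eq.symm
  have hφ : ∀ (u : V) (w : W), β (de.symm (ae u)) w = β u w := by
    intro u w
    have h1 : d (de.symm (ae u)) = a u := de.apply_symm_apply (ae u)
    exact LinearMap.congr_fun h1 w
  refine hVW ⟨ae.trans de.symm, fun h hh u v huv ↦ ?_⟩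
  have hAd : groupAd h (de.symm (ae u) : GroupLieAlgebra 𝓘(ℝ, E) G) ∈ W :=
    hW.1 h hh _ (de.symm (ae u)).2
  refine sub_eq_zero.1 (hWW' _ (W.sub_mem (de.symm (ae v)).2 hAd) fun z hz ↦ ?_)
  have hz' : groupAd h⁻¹ z ∈ W := hW.1 _ (H.inv_mem hh) z hz
  have h1 : β (de.symm (ae v)) z = β u (groupAd h⁻¹ z) := by
    rw [hφ v ⟨z, hz⟩, huv, ← hinv h hh u (groupAd h⁻¹ z), groupAd_groupAd_inv]
  have h2 : β (groupAd h (de.symm (ae u))) z = β u (groupAd h⁻¹ z) := by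
    rw [← hφ u ⟨_, hz'⟩, ← hinv h hh (de.symm (ae u)), groupAd_groupAd_inv]
  rw [map_sub, LinearMap.sub_apply]
  exact sub_eq_zero.2 (h1.trans h2.symm)

end Schur

/-! ### Covariant derivatives on a space with three summands -/

section ThreeSummands

variable {E : Type*} [NormedAddCommGroup E] [NormedSpace ℝ E] [CompleteSpace E]
  {G : Type*} [TopologicalSpace G] [ChartedSpace E G] [Group G] [LieGroup 𝓘(ℝ, E) ∞ G]
  {H : Subgroup G} {𝔪 : Submodule ℝ (GroupLieAlgebra 𝓘(ℝ, E) G)}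
  {m : Fin 3 → Submodule ℝ (GroupLieAlgebra 𝓘(ℝ, E) G)}

theorem IsThreeSummandReductive.summand_le (hm : IsThreeSummandReductive H 𝔪 m) (i : Fin 3) :
    m i ≤ 𝔪 :=
  hm.iSup_eq ▸ le_iSup m i

theorem IsThreeSummandReductive.lie_mem_of_ne (hm : IsThreeSummandReductive H 𝔪 m)
    {i j k : Fin 3} (hij : i ≠ j) (hki : k ≠ i) (hkj : k ≠ j) {x y : GroupLieAlgebra 𝓘(ℝ, E) G}
    (hx : x ∈ m i) (hy : y ∈ m j) : ⁅x, y⁆ ∈ m k := by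
  have hcases : (j = i + 1 ∧ k = i + 2) ∨ (i = j + 1 ∧ k = j + 2) := by
    clear hx hy x y
    revert i j k; decide
  rcases hcases with ⟨rfl, rfl⟩ | ⟨rfl, rfl⟩
  · exact hm.bracket_mem i x hx y hy
  · rw [← lie_skew]
    exact (m _).neg_mem (hm.bracket_mem j y hy x hx)

variable {F : Type*} [NormedAddCommGroup F] [NormedSpace ℝ F]
  {M : Type*} [TopologicalSpace M] [ChartedSpace F M] {act : G → M → M}
  {f : (p : M) → TangentSpace 𝓘(ℝ, F) p →L[ℝ] TangentSpace 𝓘(ℝ, F) p}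

/-- At the point in question, the values of `f` are tangent to `m i`. -/
theorem exists_affinor_infinitesimalAction_eq (hm : IsThreeSummandReductive H 𝔪 m) {p : M}
    {i : Fin 3} {J : m i →ₗ[ℝ] m i}
    (hJ : ∀ x : m i, f p (infinitesimalAction act p (x : GroupLieAlgebra 𝓘(ℝ, E) G)) =
      infinitesimalAction act p (J x : GroupLieAlgebra 𝓘(ℝ, E) G))
    (hf0 : ∀ j, j ≠ i → ∀ x ∈ m j, f p (infinitesimalAction act p x) = 0)
    {A : GroupLieAlgebra 𝓘(ℝ, E) G} (hA : A ∈ 𝔪) :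
    ∃ x ∈ m i, f p (infinitesimalAction act p A) = infinitesimalAction act p x := by
  rw [← hm.iSup_eq] at hA
  induction hA using Submodule.iSup_induction' with
  | mem k C hC =>
    by_cases hki : k = i
    · subst hki
      exact ⟨_, (J ⟨C, hC⟩).2, hJ ⟨C, hC⟩⟩
    · exact ⟨0, (m i).zero_mem, by rw [hf0 k hki C hC, map_zero]⟩
  | zero => exact ⟨0, (m i).zero_mem, by rw [map_zero, map_zero]⟩
  | add C D _ _ hC hD =>
    obtain ⟨x, hx, hfx⟩ := hC
    obtain ⟨y, hy, hfy⟩ := hD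
    exact ⟨x + y, (m i).add_mem hx hy, by rw [map_add, map_add, hfx, hfy, map_add]⟩

variable [CompleteSpace F] [IsManifold 𝓘(ℝ, F) ∞ M]
  {g : Bundle.ContMDiffRiemannianMetric 𝓘(ℝ, F) ∞ F (fun p : M ↦ TangentSpace 𝓘(ℝ, F) p)}
  {nabla : CovariantDerivative 𝓘(ℝ, F) F (fun p : M ↦ TangentSpace 𝓘(ℝ, F) p)}

/-- In the directions of `m i`, the covariant derivative of the fundamental field of `x ∈ m i`
vanishes. In Koszul's formula the brackets of `m i` with itself lie in `𝔥` and do not act, and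
those of `m i` with another summand are orthogonal to `m i`. -/
theorem nabla_fundamentalField_eq_zero (hm : IsThreeSummandReductive H 𝔪 m)
    (h : IsSmoothAction E F act) (hnabla : IsLeviCivita g nabla)
    (hg : ∀ (x : G) (q : M) (v w : TangentSpace 𝓘(ℝ, F) q),
      g.inner (act x q) (mfderiv 𝓘(ℝ, F) 𝓘(ℝ, F) (act x) q v)
        (mfderiv 𝓘(ℝ, F) 𝓘(ℝ, F) (act x) q w) = g.inner q v w)
    {p : M} (hker : ∀ A ∈ subgroupLieAlgebra (E := E) H, infinitesimalAction (F := F) act p A = 0)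
    (hsurj : ∀ v : TangentSpace 𝓘(ℝ, F) p, ∃ A ∈ 𝔪, infinitesimalAction act p A = v)
    (horth : ∀ i j, i ≠ j → ∀ x ∈ m i, ∀ y ∈ m j,
      g.inner p (infinitesimalAction act p x) (infinitesimalAction act p y) = 0)
    {i : Fin 3} {x y : GroupLieAlgebra 𝓘(ℝ, E) G} (hx : x ∈ m i) (hy : y ∈ m i) :
    nabla (fundamentalField act x) p (infinitesimalAction act p y) = 0 := by
  by_contra hne
  set u : TangentSpace 𝓘(ℝ, F) p :=
    nabla (fundamentalField act x) p (infinitesimalAction act p y)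
  have key : ∀ C ∈ 𝔪, g.inner p u (infinitesimalAction act p C) = 0 := by
    intro C hC
    rw [← hm.iSup_eq] at hC
    induction hC using Submodule.iSup_induction' with
    | mem k C hC =>
      have h1 := h.two_mul_metric_nabla_fundamentalField hnabla hg p x y C
      have h2 : ∀ z ∈ m i, ∀ w ∈ m i, g.inner p (infinitesimalAction act p ⁅z, C⁆)
          (infinitesimalAction act p w) = 0 := by
        intro z hz w hw
        by_cases hki : k = i
        · subst hki
          rw [hker _ (hm.bracket_self_mem k z hz C hC), map_zero, zero_apply]
        · obtain ⟨l, hli, hlk⟩ : ∃ l : Fin 3, l ≠ i ∧ l ≠ k := by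
            exact (by decide : ∀ i k : Fin 3, ∃ l : Fin 3, l ≠ i ∧ l ≠ k) i k
          exact horth l i hli _ (hm.lie_mem_of_ne (Ne.symm hki) hli hlk hz hC) _ hw
      rw [hker _ (hm.bracket_self_mem i y hy x hx), h2 y hy x hx, h2 x hx y hy, map_zero,
        zero_apply] at h1
      simpa using h1
    | zero => rw [map_zero, map_zero]
    | add C D _ _ hC hD => rw [map_add, map_add, hC, hD, add_zero]
  obtain ⟨A, hA, hAu⟩ := hsurj u
  have h1 := key A hA
  rw [hAu] at h1
  exact (g.pos p u hne).ne' h1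

/-- If `(f, g)` is a Killing `f`-structure, then the brackets of the two summands that `f` kills
are orthogonal to the third. For `b = J x` with `x ∈ m i`, the component along `w ∈ m k` of
`∇_X (f) X = 0` for the fundamental field `X` of `x + y` reads
`g([b, y], w) + g([b, w], y) + g([y, w], b) = 0`. Exchanging the roles of `y` and `w` changes only
the sign of the last term. -/
theorem metric_eq_zero_of_isKillingF (hm : IsThreeSummandReductive H 𝔪 m)
    (h : IsSmoothAction E F act) (hnabla : IsLeviCivita g nabla)
    (hg : ∀ (x : G) (q : M) (v w : TangentSpace 𝓘(ℝ, F) q),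
      g.inner (act x q) (mfderiv 𝓘(ℝ, F) 𝓘(ℝ, F) (act x) q v)
        (mfderiv 𝓘(ℝ, F) 𝓘(ℝ, F) (act x) q w) = g.inner q v w)
    (hfm : IsMetricFStructure g f)
    (hf : ∀ (x : G) (q : M) (v : TangentSpace 𝓘(ℝ, F) q),
      mfderiv 𝓘(ℝ, F) 𝓘(ℝ, F) (act x) q (f q v) =
        f (act x q) (mfderiv 𝓘(ℝ, F) 𝓘(ℝ, F) (act x) q v))
    {p : M} (hker : ∀ A ∈ subgroupLieAlgebra (E := E) H, infinitesimalAction (F := F) act p A = 0)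
    (horth : ∀ i j, i ≠ j → ∀ x ∈ m i, ∀ y ∈ m j,
      g.inner p (infinitesimalAction act p x) (infinitesimalAction act p y) = 0)
    {i j k : Fin 3} (hij : i ≠ j) (hik : i ≠ k) (hjk : j ≠ k)
    {J : m i →ₗ[ℝ] m i} (hJJ : ∀ x, J (J x) = -x)
    (hJ : ∀ x : m i, f p (infinitesimalAction act p (x : GroupLieAlgebra 𝓘(ℝ, E) G)) =
      infinitesimalAction act p (J x : GroupLieAlgebra 𝓘(ℝ, E) G))
    (hf0 : ∀ j, j ≠ i → ∀ x ∈ m j, f p (infinitesimalAction act p x) = 0)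
    (hK : IsKillingF nabla f)
    {b y w : GroupLieAlgebra 𝓘(ℝ, E) G} (hb : b ∈ m i) (hy : y ∈ m j) (hw : w ∈ m k) :
    g.inner p (infinitesimalAction act p ⁅y, w⁆) (infinitesimalAction act p b) = 0 := by
  set P : GroupLieAlgebra 𝓘(ℝ, E) G →L[ℝ] TangentSpace 𝓘(ℝ, F) p := infinitesimalAction act p
    with hP
  have key : ∀ {j k : Fin 3}, i ≠ j → i ≠ k → j ≠ k → ∀ {y w}, y ∈ m j → w ∈ m k →
      g.inner p (P ⁅b, y⁆) (P w) + g.inner p (P ⁅b, w⁆) (P y) +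
        g.inner p (P ⁅y, w⁆) (P b) = 0 := by
    intro j k hij hik hjk y w hy hw
    -- `x = -J b` is the vector with `J x = b`
    let x : m i := -J ⟨b, hb⟩
    have hJx : J x = ⟨b, hb⟩ := by
      rw [map_neg, hJJ, neg_neg]
    have hfx : f p (P (x + y : GroupLieAlgebra 𝓘(ℝ, E) G)) = P b := by
      rw [map_add, map_add, hJ, hf0 j hij.symm y hy, hJx, add_zero]
    have h1 := hK _ (h.contMDiff_fundamentalField (x + y : GroupLieAlgebra 𝓘(ℝ, E) G)) p
    rw [h.nablaAffinor_eq hnabla hfm hf (A := (x + y : GroupLieAlgebra 𝓘(ℝ, E) G)) rfl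
      (h.mdifferentiableAt_fundamentalField _ p)] at h1
    have h2 : fundamentalField act (x + y : GroupLieAlgebra 𝓘(ℝ, E) G) p = P (x + y) := rfl
    rw [h2, hfx] at h1
    have h3 := congrArg (fun v ↦ g.inner p v (P w)) h1
    simp only [map_sub, sub_apply, map_zero, zero_apply] at h3
    have h4 := hfm.compatible p
      (nabla (fundamentalField act (x + y : GroupLieAlgebra 𝓘(ℝ, E) G)) p (P (x + y))) (P w)
    rw [hf0 k hik.symm w hw, map_zero, add_zero] at h4
    rw [h4, sub_zero] at h3
    have h5 := h.two_mul_metric_nabla_fundamentalField hnabla hg p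
      (x + y : GroupLieAlgebra 𝓘(ℝ, E) G) b w
    rw [← hP, h3] at h5
    simp only [lie_add, add_lie, map_add, add_apply] at h5
    rw [hker _ (hm.bracket_self_mem i b hb x x.2),
      horth j i hij.symm _ (hm.lie_mem_of_ne hik hij.symm hjk hb hw) _ x.2,
      horth j i hij.symm _ (hm.lie_mem_of_ne hik hij.symm hjk x.2 hw) _ hb, map_zero,
      zero_apply] at h5
    linarith
  have h1 := key hij hik hjk hy hw
  have h2 := key hik hij hjk.symm hw hy
  rw [← lie_skew w y, map_neg, map_neg, neg_apply] at h2
  linarith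

end ThreeSummands

theorem theorem2
    {E : Type*} [NormedAddCommGroup E] [NormedSpace ℝ E] [FiniteDimensional ℝ E]
    {G : Type*} [TopologicalSpace G] [ChartedSpace E G] [Group G] [LieGroup 𝓘(ℝ, E) ∞ G]
    [CompleteSpace E]
    [T2Space G] [ConnectedSpace G] [CompactSpace G]
    (H : Subgroup G) (hH : IsClosed (H : Set G))
    {F : Type*} [NormedAddCommGroup F] [NormedSpace ℝ F] [FiniteDimensional ℝ F]
    [ChartedSpace F (G ⧸ H)] [IsManifold 𝓘(ℝ, F) ∞ (G ⧸ H)]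
    (hπ : Manifold.IsSubmersion 𝓘(ℝ, E) 𝓘(ℝ, F) ∞ (fun x : G ↦ (x : G ⧸ H)))
    (𝔪 : Submodule ℝ (GroupLieAlgebra 𝓘(ℝ, E) G))
    (m : Fin 3 → Submodule ℝ (GroupLieAlgebra 𝓘(ℝ, E) G))
    (hm : IsThreeSummandReductive H 𝔪 m)
    (g : Bundle.ContMDiffRiemannianMetric 𝓘(ℝ, F) ∞ F (fun p : G ⧸ H ↦ TangentSpace 𝓘(ℝ, F) p))
    (hg : IsInvariantMetric g)
    (nabla : CovariantDerivative 𝓘(ℝ, F) F (fun p : G ⧸ H ↦ TangentSpace 𝓘(ℝ, F) p))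
    (hnabla : IsLeviCivita g nabla)
    (f : (p : G ⧸ H) → TangentSpace 𝓘(ℝ, F) p →L[ℝ] TangentSpace 𝓘(ℝ, F) p)
    (hf : IsMetricFStructure g f) (hfinv : IsInvariantAffinor f)
    (i : Fin 3) (hfi : IsComplexOnSummand m i f) :
    ¬ IsKillingF nabla f ∧ IsNearlyKahlerF nabla f ∧ IsG1F nabla f := by
  have : CompleteSpace F := FiniteDimensional.complete ℝ F
  obtain ⟨⟨J, hJJ, hJ⟩, hf0⟩ := hfi
  let o : G ⧸ H := ((1 : G) : G ⧸ H)
  let P : GroupLieAlgebra 𝓘(ℝ, E) G →L[ℝ] TangentSpace 𝓘(ℝ, F) o := dProjection H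
  have hact := isSmoothAction_smul_quotient hπ
  have hPker : ∀ A ∈ subgroupLieAlgebra H, P A = 0 := fun A hA ↦ dProjection_eq_zero_of_mem hπ hA
  have hPinj : ∀ A ∈ 𝔪, P A = 0 → A = 0 := by
    intro A hA hPA
    have h1 : A ∈ subgroupLieAlgebra H := mem_subgroupLieAlgebra_of_dProjection_eq_zero hπ hPA
    have h2 := hm.isCompl.inf_eq_bot.le ⟨h1, hA⟩
    exact (Submodule.mem_bot ℝ).1 h2
  have hPsurj : ∀ v : TangentSpace 𝓘(ℝ, F) o, ∃ A ∈ 𝔪, P A = v := by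
    intro v
    obtain ⟨A, rfl⟩ := dProjection_surjective (E := E) hπ v
    have h1 : A ∈ subgroupLieAlgebra H ⊔ 𝔪 := hm.isCompl.sup_eq_top.ge trivial
    obtain ⟨B, hB, C, hC, rfl⟩ := Submodule.mem_sup.1 h1
    refine ⟨C, hC, ?_⟩
    change P C = P (B + C)
    rw [map_add, hPker B hB, zero_add]
  have hPorth : ∀ i j, i ≠ j → ∀ x ∈ m i, ∀ y ∈ m j, g.inner o (P x) (P y) = 0 := by
    intro i j hij x hx y hy
    let β : LinearMap.BilinForm ℝ (GroupLieAlgebra 𝓘(ℝ, E) G) :=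
      LinearMap.mk₂ ℝ (fun x y ↦ g.inner o (P x) (P y))
        (fun x y z ↦ by rw [map_add, map_add, add_apply])
        (fun c x y ↦ by rw [map_smul, map_smul, smul_apply])
        (fun x y z ↦ by rw [map_add, map_add])
        (fun c x y ↦ by rw [map_smul, map_smul])
    -- Schur's lemma for the metric at `o`, transported to the Lie algebra
    refine bilinForm_eq_zero_of_not_areAdEquivalent (H := H) β (fun x y ↦ g.symm o _ _) ?_
      (hm.irreducible i) (hm.irreducible j) (hm.inequivalent i j hij) ?_ hx hy
    · intro h hh x y
      have h1 := hg h o (P x) (P y)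
      have h2 : ∀ (q : G ⧸ H) (v w v' w' : F), q = o → v = v' → w = w' →
          g.inner q v w = g.inner o v' w' := by
        rintro _ v w _ _ rfl rfl rfl; rfl
      have h3 : h • o = o := QuotientGroup.eq.2 (by simpa using hh)
      exact (h2 _ _ _ _ _ h3 (dTranslation_dProjection hπ hh x)
        (dTranslation_dProjection hπ hh y)).symm.trans h1
    · intro z hz hz0
      by_contra hne
      exact (g.pos o (P z) fun h ↦ hne (hPinj z (hm.summand_le j hz) h)).ne' hz0
  -- the data at an arbitrary point `a • o`, for the action by the conjugates `a * x * a⁻¹`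
  have hconj := fun a : G ↦ hact.conj a
  have hQ : ∀ (a : G) (A : GroupLieAlgebra 𝓘(ℝ, E) G),
      (infinitesimalAction (F := F) (fun (x : G) (q : G ⧸ H) ↦ (a * x * a⁻¹) • q) (a • o) A : F) =
        dTranslation (F := F) a o (P A) := by
    intro a A
    refine (hact.infinitesimalAction_conj a o A).trans ?_
    exact congrArg (dTranslation (F := F) a o) (infinitesimalAction_smul_one A)
  have hQker : ∀ (a : G), ∀ A ∈ subgroupLieAlgebra (E := E) H,
      infinitesimalAction (F := F) (fun (x : G) (q : G ⧸ H) ↦ (a * x * a⁻¹) • q) (a • o) A = 0 := by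
    intro a A hA
    refine (hQ a A).trans ?_
    rw [hPker A hA, map_zero]
  have hQsurj : ∀ (a : G) (v : TangentSpace 𝓘(ℝ, F) (a • o)), ∃ A ∈ 𝔪,
      infinitesimalAction (E := E) (F := F) (fun (x : G) (q : G ⧸ H) ↦ (a * x * a⁻¹) • q)
        (a • o) A = v := by
    intro a v
    obtain ⟨A, hA, hAv⟩ := hPsurj
      (mfderiv 𝓘(ℝ, F) 𝓘(ℝ, F) (fun q : G ⧸ H ↦ a⁻¹ • q) (a • o) v : F)
    refine ⟨A, hA, (hQ a A).trans ?_⟩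
    rw [hAv]
    exact hact.mfderiv_act_mfderiv_act_inv a o v
  have hQinner : ∀ (a : G) (A B : GroupLieAlgebra 𝓘(ℝ, E) G),
      g.inner (a • o)
        (infinitesimalAction (F := F) (fun (x : G) (q : G ⧸ H) ↦ (a * x * a⁻¹) • q) (a • o) A)
        (infinitesimalAction (F := F) (fun (x : G) (q : G ⧸ H) ↦ (a * x * a⁻¹) • q) (a • o) B) =
      g.inner o (P A) (P B) := by
    intro a A B
    refine Eq.trans ?_ (hg a o (P A) (P B))
    exact congrArg₂ (fun v w ↦ g.inner (a • o) v w) (hQ a A) (hQ a B)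
  have hQorth := fun (a : G) i j (hij : i ≠ j) x (hx : x ∈ m i) y (hy : y ∈ m j) ↦
    (hQinner a x y).trans (hPorth i j hij x hx y hy)
  have hQJ : ∀ (a : G) (x : m i), f (a • o)
      (infinitesimalAction (F := F) (fun (x : G) (q : G ⧸ H) ↦ (a * x * a⁻¹) • q) (a • o)
        (x : GroupLieAlgebra 𝓘(ℝ, E) G)) =
      infinitesimalAction (F := F) (fun (x : G) (q : G ⧸ H) ↦ (a * x * a⁻¹) • q) (a • o)
        (J x : GroupLieAlgebra 𝓘(ℝ, E) G) := by
    intro a x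
    refine (congrArg (f (a • o)) (hQ a x)).trans ?_
    refine ((hfinv a o (P x)).symm.trans ?_).trans (hQ a (J x)).symm
    exact congrArg (dTranslation (F := F) a o) (hJ x)
  have hQ0 : ∀ (a : G), ∀ j, j ≠ i → ∀ x ∈ m j, f (a • o)
      (infinitesimalAction (F := F) (fun (x : G) (q : G ⧸ H) ↦ (a * x * a⁻¹) • q) (a • o) x) =
      0 := by
    intro a j hj x hx
    refine (congrArg (f (a • o)) (hQ a x)).trans ?_
    refine (hfinv a o (P x)).symm.trans ?_
    refine (congrArg (dTranslation (F := F) a o) (hf0 j hj x hx)).trans (map_zero _)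
  -- `f X` agrees at `a • o` with the fundamental field of some `x ∈ m i`
  have hNK : IsNearlyKahlerF nabla f := by
    intro X hX p
    obtain ⟨a, rfl⟩ := QuotientGroup.mk_surjective p
    have hao : (a : G ⧸ H) = a • o := congrArg _ (mul_one a).symm
    rw [hao]
    obtain ⟨A, hA, hAX⟩ := hQsurj a (X (a • o))
    obtain ⟨x, hx, hfx⟩ := exists_affinor_infinitesimalAction_eq hm (hQJ a) (hQ0 a) hA
    obtain ⟨y, hy, hfy⟩ := exists_affinor_infinitesimalAction_eq hm (hQJ a) (hQ0 a)
      (hm.summand_le i hx)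
    have hfX : affinorApply f X (a • o) = infinitesimalAction (F := F)
        (fun (x : G) (q : G ⧸ H) ↦ (a * x * a⁻¹) • q) (a • o) x := by
      rw [← hfx, hAX]
      rfl
    have h1 := (hconj a).nablaAffinor_eq hnabla hf (fun x q v ↦ hfinv (a * x * a⁻¹) q v) hfX
      (hf.mdifferentiableAt_affinorApply (hX.mdifferentiable (by simp) (a • o)))
    rw [h1, hfX, hfy,
      nabla_fundamentalField_eq_zero hm (hconj a) hnabla (fun x q v w ↦ hg (a * x * a⁻¹) q v w)
        (hQker a) (hQsurj a) (hQorth a) hx hy,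
      nabla_fundamentalField_eq_zero hm (hconj a) hnabla (fun x q v w ↦ hg (a * x * a⁻¹) q v w)
        (hQker a) (hQsurj a) (hQorth a) hx hx, map_zero, sub_zero]
  refine ⟨fun hK ↦ ?_, hNK, fun X hX p ↦ ?_⟩
  · obtain ⟨y, hy, w, hw, hyw⟩ := hm.bracket_ne (i + 1)
    have hne : i ≠ i + 1 ∧ i ≠ i + 1 + 1 ∧ i + 1 ≠ i + 1 + 1 := by
      exact (by decide : ∀ i : Fin 3, i ≠ i + 1 ∧ i ≠ i + 1 + 1 ∧ i + 1 ≠ i + 1 + 1) i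
    have hmem : ⁅y, w⁆ ∈ m i := hm.lie_mem_of_ne hne.2.2 hne.1 hne.2.1 hy hw
    have h1 := metric_eq_zero_of_isKillingF hm (hconj 1) hnabla
      (fun x q v w ↦ hg (1 * x * 1⁻¹) q v w) hf (fun x q v ↦ hfinv (1 * x * 1⁻¹) q v)
      (hQker 1) (hQorth 1) hne.1 hne.2.1 hne.2.2 hJJ (hQJ 1) (hQ0 1) hK hmem hy hw
    rw [hQinner] at h1
    exact (g.pos o (P ⁅y, w⁆) fun h ↦ hyw (hPinj _ (hm.summand_le i hmem) h)).ne' h1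
  · have hfX : IsSmoothVectorField (affinorApply f X) := fun q ↦
      ContMDiffAt.clm_bundle_apply (F₁ := F) (F₂ := F) (hf.smooth q) (hX q)
    rw [compositionTensor, hNK X hX p, hNK _ hfX p, sub_zero, map_zero, smul_zero]
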